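/- A weighted mixed graph $G=(V,E,A)$ consists of a finite vertex set $V$, a set $E\subseteq\binom V2$ of undirected edges $e$ with positive integer weights $w_e$, and a set $A\subseteq V\times V$ of arcs. A path from $s$ to $t$ in $G$ is a sequence $v_1,\dots,v_m$ ($m\ge 1$) of pairwise distinct vertices with $v_1=s$, $v_m=t$ such that for every $1\le i<m$ either $\{v_i,v_{i+1}\}\in E$ or $(v_i,v_{i+1})\in A$. An instance $(G,\mathcal T)$ of Crossing Cost Multi-Agent Routing (CC-MAR) consists of a weighted mixed graph $G$ and a multiset $\mathcal T=\{(s_1,t_1),\dots,(s_k,t_k)\}$ of $k\ge 1$ pairs of vertices. It is feasible if for every $i$ there is a path from $s_i$ to $t_i$ in $G$. A solution is a family $\mathcal P=(P_1,\dots,P_k)$ where $P_i$ is a path from $s_i$ to $t_i$ in $G$. Its cost is $$\mathrm{cost}(\mathcal P)=\sum_{\{u,v\}\in E} w_{uv}\,x_{uv}\,x_{vu},$$ where $x_{uv}$ is the number of indices $i$ such that $u$ is immediately followed by $v$ on $P_i$. A minimum-cost solution is a solution whose cost is least among all solutions. Theorem. There is an algorithm that, given a feasible CC-MAR instance $(G,\mathcal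 T)$ with $k\ge 1$ terminal pairs, computes a minimum-cost solution in time $|V|^{O(k^2)}\cdot k^{O(1)}$. Here time is measured on a unit-cost random access machine whose arithmetic operations are addition and (truncated) subtraction of natural numbers and whose input is given by the weighted adjacency matrix of $E$, the adjacency matrix of $A$ and the list of terminal pairs; the time bound means that there is a constant $C$, independent of the instance, such that at most $C\cdot|V|^{Ck^2}\cdot k^{C}$ steps are made. -/

import Mathlib

/-! ## Crossing Cost Multi-Agent Routing -/

namespace CCMAR

/-- A weighted mixed graph `(V, E, A)`: a set `E` of undirected edges (unordered pairs of distinct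
vertices), a set `A ⊆ V × V` of arcs, and positive integer weights on the undirected edges (the
values of `weight` outside `E` are never used; the unweighted case is `weight = 1`). -/
structure MixedGraph (V : Type*) where
  edges : SimpleGraph V
  arcs : Set (V × V)
  weight : Sym2 V → ℕ
  weight_pos : ∀ e ∈ edges.edgeSet, 0 < weight e

namespace MixedGraph

variable {V : Type*} (G : MixedGraph V)

/-- One step of a path: along an undirected edge in either direction, or along an arc. -/
def Step (u v : V) : Prop := G.edges.Adj u v ∨ (u, v) ∈ G.arcs

/-- `p` is a path of `G` from `s` to `t`: a nonempty sequence of pairwise distinct vertices, in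
which consecutive vertices are joined by an edge or by a forward arc. -/
def IsPath (s t : V) (p : List V) : Prop :=
  p.Nodup ∧ p.IsChain G.Step ∧ p.head? = some s ∧ p.getLast? = some t

end MixedGraph

/-- The vertices `u`, `v` are consecutive, in this order, on `p`. -/
def Traverses {V : Type*} (p : List V) (u v : V) : Prop := [u, v] <:+: p

/-- An instance with `k` agents: a weighted mixed graph and `k` (not necessarily distinct)
terminal pairs. -/
structure Inst (V : Type*) (k : ℕ) where
  graph : MixedGraph V
  source : Fin k → V
  target : Fin k → V

/-- `x_{uv}`: the number of agents whose path goes from `u` directly to `v`. -/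
noncomputable def load {V : Type*} {k : ℕ} (P : Fin k → List V) (u v : V) : ℕ :=
  Nat.card {i : Fin k // Traverses (P i) u v}

namespace Inst

variable {V : Type*} {k : ℕ} (Γ : Inst V k)

/-- A feasible solution (strategy profile): a path from `sᵢ` to `tᵢ` for every agent `i`. -/
def IsSolution (P : Fin k → List V) : Prop :=
  ∀ i, Γ.graph.IsPath (Γ.source i) (Γ.target i) (P i)

/-- Every agent has at least one path between its terminals. -/
def Feasible : Prop :=
  ∀ i, ∃ p, Γ.graph.IsPath (Γ.source i) (Γ.target i) p

open Classical in
/-- The total cost `∑_{{u,v} ∈ E} w_{uv} x_{uv} x_{vu}` of a profile. -/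
noncomputable def cost [Fintype V] (P : Fin k → List V) : ℕ :=
  ∑ e ∈ Γ.graph.edges.edgeFinset, Γ.graph.weight e *
    Sym2.lift ⟨fun u v => load P u v * load P v u, fun _ _ => mul_comm _ _⟩ e

/-- `P` is a minimum-cost solution. -/
def IsOptimal [Fintype V] (P : Fin k → List V) : Prop :=
  Γ.IsSolution P ∧ ∀ Q, Γ.IsSolution Q → Γ.cost P ≤ Γ.cost Q

end Inst

end CCMAR

/-! ## A unit-cost random access machine

The state consists of registers and of one-way infinite arrays, all holding natural numbers. A
program is a finite text, so it names only finitely many registers and arrays; arrays have indirect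
addressing. The only arithmetic is addition and truncated subtraction (no multiplication), so the
unit-cost measure is the usual one. -/

namespace RAM

/-- A machine state: register `r` holds `reg r`, cell `i` of array `a` holds `arr a i`. -/
structure State where
  reg : ℕ → ℕ
  arr : ℕ → ℕ → ℕ

/-- Arithmetic expressions; `load a e` reads the cell of array `a` whose index is the value of
`e`. -/
inductive Expr where
  | const (c : ℕ)
  | reg (r : ℕ)
  | add (e₁ e₂ : Expr)
  | sub (e₁ e₂ : Expr)
  | load (a : ℕ) (e : Expr)

namespace Expr

/-- The value of an expression; subtraction is truncated at `0`. -/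
def eval (σ : State) : Expr → ℕ
  | const c => c
  | reg r => σ.reg r
  | add e₁ e₂ => e₁.eval σ + e₂.eval σ
  | sub e₁ e₂ => e₁.eval σ - e₂.eval σ
  | load a e => σ.arr a (e.eval σ)

/-- The time to evaluate an expression: one unit for every operation, operand and memory access. -/
def time : Expr → ℕ
  | const _ => 1
  | reg _ => 1
  | add e₁ e₂ => e₁.time + e₂.time + 1
  | sub e₁ e₂ => e₁.time + e₂.time + 1
  | load _ e => e.time + 1

end Expr

/-- Programs. Tests are of the form `e ≠ 0`. -/
inductive Prog where
  | skip
  | assign (r : ℕ) (e : Expr)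
  | store (a : ℕ) (i e : Expr)
  | seq (p q : Prog)
  | ite (e : Expr) (p q : Prog)
  | while (e : Expr) (p : Prog)

namespace State

def setReg (σ : State) (r v : ℕ) : State :=
  { σ with reg := Function.update σ.reg r v }

def setArr (σ : State) (a i v : ℕ) : State :=
  { σ with arr := Function.update σ.arr a (Function.update (σ.arr a) i v) }

end State

/-- `Exec p σ σ₁ t`: started in state `σ`, the program `p` halts in state `σ₁` after exactly `t`
time units. -/
inductive Exec : Prog → State → State → ℕ → Prop where
  | skip (σ : State) : Exec .skip σ σ 1
  | assign (σ : State) (r : ℕ) (e : Expr) :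
      Exec (.assign r e) σ (σ.setReg r (e.eval σ)) (e.time + 1)
  | store (σ : State) (a : ℕ) (i e : Expr) :
      Exec (.store a i e) σ (σ.setArr a (i.eval σ) (e.eval σ)) (i.time + e.time + 1)
  | seq {p q : Prog} {σ σ₁ σ₂ : State} {t₁ t₂ : ℕ} :
      Exec p σ σ₁ t₁ → Exec q σ₁ σ₂ t₂ → Exec (.seq p q) σ σ₂ (t₁ + t₂)
  | ite_true {e : Expr} {p q : Prog} {σ σ₁ : State} {t : ℕ} :
      e.eval σ ≠ 0 → Exec p σ σ₁ t → Exec (.ite e p q) σ σ₁ (e.time + 1 + t)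
  | ite_false {e : Expr} {p q : Prog} {σ σ₁ : State} {t : ℕ} :
      e.eval σ = 0 → Exec q σ σ₁ t → Exec (.ite e p q) σ σ₁ (e.time + 1 + t)
  | while_true {e : Expr} {p : Prog} {σ σ₁ σ₂ : State} {t₁ t₂ : ℕ} :
      e.eval σ ≠ 0 → Exec p σ σ₁ t₁ → Exec (.while e p) σ₁ σ₂ t₂ →
      Exec (.while e p) σ σ₂ (e.time + 1 + t₁ + t₂)
  | while_false {e : Expr} {p : Prog} {σ : State} :
      e.eval σ = 0 → Exec (.while e p) σ σ (e.time + 1)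

/-- The machine is deterministic: final state and running time are determined by the input. -/
theorem Exec.deterministic {p : Prog} {σ σ₁ σ₂ : State} {t₁ t₂ : ℕ}
    (h₁ : Exec p σ σ₁ t₁) (h₂ : Exec p σ σ₂ t₂) : σ₁ = σ₂ ∧ t₁ = t₂ := by
  induction h₁ generalizing σ₂ t₂ with
  | skip | assign | store => cases h₂; exact ⟨rfl, rfl⟩
  | seq _ _ ih₁ ih₂ =>
    cases h₂ with
    | seq k₁ k₂ =>
      obtain ⟨rfl, rfl⟩ := ih₁ k₁
      obtain ⟨rfl, rfl⟩ := ih₂ k₂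
      exact ⟨rfl, rfl⟩
  | ite_true he _ ih =>
    cases h₂ with
    | ite_true _ k => obtain ⟨rfl, rfl⟩ := ih k; exact ⟨rfl, rfl⟩
    | ite_false he₂ _ => exact absurd he₂ he
  | ite_false he _ ih =>
    cases h₂ with
    | ite_true he₂ _ => exact absurd he he₂
    | ite_false _ k => obtain ⟨rfl, rfl⟩ := ih k; exact ⟨rfl, rfl⟩
  | while_true he _ _ ih₁ ih₂ =>
    cases h₂ with
    | while_true _ k₁ k₂ =>
      obtain ⟨rfl, rfl⟩ := ih₁ k₁
      obtain ⟨rfl, rfl⟩ := ih₂ k₂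
      exact ⟨rfl, rfl⟩
    | while_false he₂ => exact absurd he₂ he
  | while_false he =>
    cases h₂ with
    | while_true he₂ _ _ => exact absurd he he₂
    | while_false _ => exact ⟨rfl, rfl⟩

end RAM

/-! ## Input and output -/

namespace CCMAR

/-- The array of `n * n` cells holding the matrix `M` row by row. -/
def matrixArray {n : ℕ} (M : Fin n → Fin n → ℕ) (a : ℕ) : ℕ :=
  if h : a < n * n then
    M (finProdFinEquiv.symm ⟨a, h⟩).1 (finProdFinEquiv.symm ⟨a, h⟩).2
  else 0

/-- The array of `k` cells holding the vertices `f 0, …, f (k - 1)`. -/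
def vertexArray {n k : ℕ} (f : Fin k → Fin n) (a : ℕ) : ℕ :=
  if h : a < k then (f ⟨a, h⟩ : ℕ) else 0

open Classical in
/-- The initial state for an instance on the vertices `0, …, n - 1`: register `0` holds `n`,
register `1` holds `k`, array `0` holds the weighted adjacency matrix of the undirected edges (with
`0` for a non-edge), array `1` the adjacency matrix of the arcs, arrays `2` and `3` the sources and
the targets of the agents. Everything else is `0`. -/
noncomputable def inputState {n k : ℕ} (Γ : Inst (Fin n) k) : RAM.State where
  reg
    | 0 => n
    | 1 => k
    | _ => 0
  arr
    | 0 => matrixArray fun u v => if Γ.graph.edges.Adj u v then Γ.graph.weight s(u, v) else 0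
    | 1 => matrixArray fun u v => if (u, v) ∈ Γ.graph.arcs then 1 else 0
    | 2 => vertexArray Γ.source
    | 3 => vertexArray Γ.target
    | _ => fun _ => 0

/-- The profile `P` is written in the state: cell `i` of array `4` holds the number of vertices of
the path of agent `i`, and the cells `i * n, i * n + 1, …` of array `5` hold its vertices in
order. -/
def IsOutput {n k : ℕ} (σ : RAM.State) (P : Fin k → List (Fin n)) : Prop :=
  ∀ i : Fin k, σ.arr 4 i = (P i).length ∧
    ∀ j : Fin (P i).length, σ.arr 5 (i * n + j) = ((P i).get j : ℕ)

end CCMAR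

/-! Only steps taken in both directions cost anything, and such steps can be made rare. Suppose `u →
v` and `v → u` are both available and `v` is reachable from `u` without the step `u → v`. A simple
path witnessing this, closed by `v → u`, is a directed cycle. All agents can be rerouted at once:
whoever takes the reverse of a cycle step goes round the cycle instead. This eliminates `u → v` and
creates no new pair of opposite steps (`exists_reroute`). Examining all ordered pairs one after the
other leaves a `Reduced` relation, in which no step with an opposite lies on a longer cycle, and the
optimum is unchanged.

In a reduced relation, a step with an opposite that lies on one simple path between two vertices of
a strong component lies on every walk between them (`Reduced.not_reach`). The cost arising inside a
component is therefore determined by the vertices where the agents enter and leave it, and steps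
between components have no opposite. The number of reachable vertices, `rank`, is constant on strong
components and drops on every step between them, so it arranges them in at most `n` levels. A
configuration lists one entrance and one exit for each agent, which gives `(n * n) ^ k`
possibilities per level, and a dynamic program over the levels finds a cheapest sequence of
configurations.

No solution beats the table, because the walks of a solution must take the forced steps of their own
configurations (`TableArray.exists_le_crossing`). Conversely, let an agent use a step with an
opposite only where the optimal sequence forces it: the target stays reachable, and any paths along
allowed steps attain the table value (`TableArray.allow_spec`). Shortest paths along allowed steps
are the output.

On the machine side, `Comp` and `CompP` describe side-effect free functions and predicates with time
polynomial in a bound `B` on the first eight registers. They are closed under substitution, case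
distinction and bounded loops, so the time bounds follow the formulas. Every array is filled by
`Comp.exists_leads_tabulate`. With `B = 4 * k * n ^ (3 * k)` the total time is even `n ^ O(k) * k ^
O(1)`. -/

namespace RAM

/-! ### Polynomial-time computation without side effects. -/

/-- `T` is bounded by a monomial on the positive naturals. -/
def PolyBound (T : ℕ → ℕ) : Prop := ∃ c d, ∀ B, 1 ≤ B → T B ≤ c * B ^ d

namespace PolyBound

theorem const (m : ℕ) : PolyBound fun _ => m := ⟨m, 0, by simp⟩

theorem id : PolyBound fun B => B := ⟨1, 1, by simp⟩

theorem add {S T : ℕ → ℕ} : PolyBound S → PolyBound T → PolyBound fun B => S B + T B := by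
  rintro ⟨c, d, h⟩ ⟨c', d', h'⟩
  refine ⟨c + c', d + d', fun B hB => ?_⟩
  have h1 : B ^ d ≤ B ^ (d + d') := Nat.pow_le_pow_right hB (by omega)
  have h2 : B ^ d' ≤ B ^ (d + d') := Nat.pow_le_pow_right hB (by omega)
  calc S B + T B ≤ c * B ^ d + c' * B ^ d' := Nat.add_le_add (h B hB) (h' B hB)
    _ ≤ c * B ^ (d + d') + c' * B ^ (d + d') := by gcongr
    _ = _ := by ring

theorem mul {S T : ℕ → ℕ} : PolyBound S → PolyBound T → PolyBound fun B => S B * T B := by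
  rintro ⟨c, d, h⟩ ⟨c', d', h'⟩
  refine ⟨c * c', d + d', fun B hB => ?_⟩
  calc S B * T B ≤ (c * B ^ d) * (c' * B ^ d') := Nat.mul_le_mul (h B hB) (h' B hB)
    _ = _ := by ring

end PolyBound

/-- `σ'` arises from `σ` by changes to the registers from `b` on only. -/
def Frame (b : ℕ) (σ σ' : State) : Prop := (∀ r < b, σ'.reg r = σ.reg r) ∧ σ'.arr = σ.arr

namespace Frame

theorem trans {b b' : ℕ} {σ₁ σ₂ σ₃ : State} (h : Frame b σ₁ σ₂) (h' : Frame b' σ₂ σ₃)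
    (hb : b ≤ b') : Frame b σ₁ σ₃ :=
  ⟨fun r hr => (h'.1 r (hr.trans_le hb)).trans (h.1 r hr), h'.2.trans h.2⟩

theorem setReg {b r : ℕ} (σ : State) (v : ℕ) (hr : b ≤ r) : Frame b σ (σ.setReg r v) :=
  ⟨fun s hs => Function.update_of_ne (by omega) _ _, rfl⟩

theorem refl (b : ℕ) (σ : State) : Frame b σ σ := ⟨fun _ _ => rfl, rfl⟩

end Frame

@[simp] theorem State.setReg_reg_self (σ : State) (r v : ℕ) : (σ.setReg r v).reg r = v :=
  Function.update_self ..

theorem State.setReg_reg_of_ne (σ : State) {r s : ℕ} (v : ℕ) (h : s ≠ r) :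
    (σ.setReg r v).reg s = σ.reg s := Function.update_of_ne h ..

@[simp] theorem State.setReg_arr (σ : State) (r v : ℕ) : (σ.setReg r v).arr = σ.arr := rfl

/-- The first eight registers and all arrays agree. -/
def Agree (E σ : State) : Prop := Frame 8 E σ

/-- In every state that agrees with `E` and holds the variable `x j` in register `ρ j`, the program
puts the value `f E x` into register `b`, leaves the registers below `b` and the arrays unchanged,
and takes time at most `T B` when the first eight registers are at most `B`. -/
def Evaluates (prog : Prog) (b : ℕ) (ρ : ℕ → ℕ) (f : State → (ℕ → ℕ) → ℕ) (T : ℕ → ℕ) : Prop :=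
  ∀ (E : State) (x : ℕ → ℕ) (B : ℕ) (σ : State), 1 ≤ B → (∀ g < 8, E.reg g ≤ B) → Agree E σ →
    (∀ j, σ.reg (ρ j) = x j) →
    ∃ σ' t, Exec prog σ σ' t ∧ t ≤ T B ∧ Frame b σ σ' ∧ σ'.reg b = f E x

/-- `f` is computable in polynomial time without side effects, from the first eight registers and
the arrays of a state and from further variables held in registers. -/
def Comp (f : State → (ℕ → ℕ) → ℕ) : Prop :=
  ∃ T, PolyBound T ∧ ∀ b ρ, 8 ≤ b → (∀ j, ρ j < b) → ∃ prog, Evaluates prog b ρ f T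

/-- The sequence `a, x 0, x 1, …`. -/
def scons (a : ℕ) (x : ℕ → ℕ) : ℕ → ℕ
  | 0 => a
  | j + 1 => x j

/-- The sequence without its first term. -/
def stail (x : ℕ → ℕ) : ℕ → ℕ := fun j => x (j + 1)

theorem scons_lt {a b : ℕ} {ρ : ℕ → ℕ} (ha : a < b) (h : ∀ j, ρ j < b) : ∀ j, scons a ρ j < b
  | 0 => ha
  | j + 1 => h j

namespace Comp

variable {f g : State → (ℕ → ℕ) → ℕ}

theorem of_expr (e : (ℕ → ℕ) → Expr) (m : ℕ) (hm : ∀ ρ, (e ρ).time ≤ m)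
    (he : ∀ E x σ ρ, Agree E σ → (∀ j, σ.reg (ρ j) = x j) → (e ρ).eval σ = f E x) : Comp f := by
  refine ⟨fun _ => m + 1, .const _, fun b ρ hb hρ => ⟨.assign b (e ρ), ?_⟩⟩
  intro E x B σ _ _ hE hx
  exact ⟨_, _, .assign σ b _, Nat.succ_le_succ (hm ρ), Frame.setReg _ _ le_rfl,
    by simp [he E x σ ρ hE hx]⟩

theorem const (m : ℕ) : Comp fun _ _ => m :=
  of_expr (fun _ => .const m) 1 (fun _ => le_rfl) fun _ _ _ _ _ _ => rfl

theorem var (j : ℕ) : Comp fun _ x => x j :=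
  of_expr (fun ρ => .reg (ρ j)) 1 (fun _ => le_rfl) fun _ _ _ _ _ hx => hx j

theorem reg (r : ℕ) (hr : r < 8 := by norm_num) : Comp fun E _ => E.reg r :=
  of_expr (fun _ => .reg r) 1 (fun _ => le_rfl) fun _ _ _ _ hE _ => hE.1 r hr

theorem rename (hf : Comp f) (π : ℕ → ℕ) : Comp fun E x => f E fun j => x (π j) := by
  obtain ⟨T, hT, h⟩ := hf
  refine ⟨T, hT, fun b ρ hb hρ => ?_⟩
  obtain ⟨p, hp⟩ := h b (fun j => ρ (π j)) hb fun j => hρ _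
  exact ⟨p, fun E x B σ h1 h2 h3 h4 => hp E _ B σ h1 h2 h3 fun j => h4 _⟩

/-- The value of `f` stays in register `b` and serves as variable `0` of `g`, whose code works from
register `b + 1` on and so preserves all variables. A final copy brings the result back to `b`. -/
theorem let_ (hf : Comp f) (hg : Comp g) : Comp fun E x => g E (scons (f E x) x) := by
  obtain ⟨S, hS, hf⟩ := hf
  obtain ⟨T, hT, hg⟩ := hg
  refine ⟨fun B => S B + (T B + 2), hS.add (hT.add (.const 2)), fun b ρ hb hρ => ?_⟩
  obtain ⟨p, hp⟩ := hf b ρ hb hρ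
  obtain ⟨q, hq⟩ := hg (b + 1) (scons b ρ) (by omega)
    (scons_lt (by omega) fun j => (hρ j).trans (by omega))
  refine ⟨.seq p (.seq q (.assign b (.reg (b + 1)))), fun E x B σ h1 h2 h3 h4 => ?_⟩
  obtain ⟨σ₁, t₁, e₁, l₁, f₁, v₁⟩ := hp E x B σ h1 h2 h3 h4
  obtain ⟨σ₂, t₂, e₂, l₂, f₂, v₂⟩ := hq E (scons (f E x) x) B σ₁ h1 h2 (h3.trans f₁ hb) (by
    rintro (_ | j)
    · exact v₁
    · exact (f₁.1 _ (hρ j)).trans (h4 j))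
  refine ⟨_, _, .seq e₁ (.seq e₂ (.assign σ₂ b _)), ?_,
    (f₁.trans f₂ (by omega)).trans (Frame.setReg _ _ le_rfl) le_rfl, ?_⟩
  · simp only [Expr.time]; omega
  · simp [Expr.eval, v₂]

/-- Substitution into a function of one variable. -/
theorem comp₁ {F : State → ℕ → ℕ} (hF : Comp fun E x => F E (x 0)) (hf : Comp f) :
    Comp fun E x => F E (f E x) := let_ hf hF

theorem comp₂ {F : State → ℕ → ℕ → ℕ} (hF : Comp fun E x => F E (x 0) (x 1)) (hf : Comp f)
    (hg : Comp g) : Comp fun E x => F E (f E x) (g E x) :=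
  let_ hf (let_ (hg.rename Nat.succ)
    -- The value bound last comes first, hence the exchange of the two variables.
    (hF.rename fun | 0 => 1 | 1 => 0 | j => j))

theorem add_var : Comp fun _ x => x 0 + x 1 :=
  of_expr (fun ρ => .add (.reg (ρ 0)) (.reg (ρ 1))) 3 (fun _ => le_rfl)
    fun _ _ _ _ _ hx => by simp [Expr.eval, hx]

theorem sub_var : Comp fun _ x => x 0 - x 1 :=
  of_expr (fun ρ => .sub (.reg (ρ 0)) (.reg (ρ 1))) 3 (fun _ => le_rfl)
    fun _ _ _ _ _ hx => by simp [Expr.eval, hx]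

theorem load_var (a : ℕ) : Comp fun E x => E.arr a (x 0) :=
  of_expr (fun ρ => .load a (.reg (ρ 0))) 2 (fun _ => le_rfl)
    fun _ _ _ _ hE hx => by simp [Expr.eval, hx, hE.2]

theorem add (hf : Comp f) (hg : Comp g) : Comp fun E x => f E x + g E x :=
  comp₂ (F := fun _ a b => a + b) add_var hf hg

theorem sub (hf : Comp f) (hg : Comp g) : Comp fun E x => f E x - g E x :=
  comp₂ (F := fun _ a b => a - b) sub_var hf hg

theorem load (a : ℕ) (hf : Comp f) : Comp fun E x => E.arr a (f E x) :=
  comp₁ (F := fun E i => E.arr a i) (load_var a) hf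

theorem congr (hf : Comp f) (h : ∀ E x, f E x = g E x) : Comp g := by
  have : f = g := by funext E x; exact h E x
  rwa [← this]

end Comp

/-- The predicate `P` is decidable in polynomial time. -/
def CompP (P : State → (ℕ → ℕ) → Prop) : Prop := ∃ f, Comp f ∧ ∀ E x, f E x ≠ 0 ↔ P E x

theorem Comp.ite {P : State → (ℕ → ℕ) → Prop} {inst : ∀ E x, Decidable (P E x)}
    {f g : State → (ℕ → ℕ) → ℕ} (hP : CompP P) (hf : Comp f) (hg : Comp g) :
    Comp fun E x => @_root_.ite _ (P E x) (inst E x) (f E x) (g E x) := by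
  obtain ⟨c, ⟨R, hR, hc⟩, hP⟩ := hP
  obtain ⟨S, hS, hf⟩ := hf
  obtain ⟨T, hT, hg⟩ := hg
  refine ⟨fun B => R B + (S B + T B + 2), hR.add ((hS.add hT).add (.const 2)), fun b ρ hb hρ => ?_⟩
  obtain ⟨r, hr⟩ := hc b ρ hb hρ
  obtain ⟨p, hp⟩ := hf b ρ hb hρ
  obtain ⟨q, hq⟩ := hg b ρ hb hρ
  refine ⟨.seq r (.ite (.reg b) p q), fun E x B σ h1 h2 h3 h4 => ?_⟩
  obtain ⟨σ₁, t₁, e₁, l₁, f₁, v₁⟩ := hr E x B σ h1 h2 h3 h4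
  have h4' : ∀ j, σ₁.reg (ρ j) = x j := fun j => (f₁.1 _ (hρ j)).trans (h4 j)
  by_cases hc : P E x
  · obtain ⟨σ₂, t₂, e₂, l₂, f₂, v₂⟩ := hp E x B σ₁ h1 h2 (h3.trans f₁ hb) h4'
    refine ⟨_, _, .seq e₁ (.ite_true (by rw [Expr.eval, v₁]; exact (hP E x).2 hc) e₂), ?_,
      f₁.trans f₂ le_rfl, v₂.trans (if_pos hc).symm⟩
    simp only [Expr.time]; omega
  · obtain ⟨σ₂, t₂, e₂, l₂, f₂, v₂⟩ := hq E x B σ₁ h1 h2 (h3.trans f₁ hb) h4'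
    refine ⟨_, _, .seq e₁ (.ite_false (by
      rw [Expr.eval, v₁]; by_contra h; exact hc ((hP E x).1 h)) e₂), ?_,
      f₁.trans f₂ le_rfl, v₂.trans (if_neg hc).symm⟩
    simp only [Expr.time]; omega

/-- `acc ↦ F i acc` performed for `i = 0, …, n - 1`, from the value `a` on. -/
def loop (n a : ℕ) (F : ℕ → ℕ → ℕ) : ℕ := Nat.rec a F n

@[simp] theorem loop_zero (a : ℕ) (F : ℕ → ℕ → ℕ) : loop 0 a F = a := rfl

theorem loop_succ (n a : ℕ) (F : ℕ → ℕ → ℕ) : loop (n + 1) a F = F n (loop n a F) := rfl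

/-- Bounding the rounds by one of the first eight registers, hence by `B`, keeps the time
polynomial. Register `b` holds the accumulator, `b + 1` the counter, and the body works from `b + 2`
on. -/
theorem Comp.loop {f : State → (ℕ → ℕ) → ℕ} {F : State → (ℕ → ℕ) → ℕ → ℕ → ℕ} (g : ℕ)
    (hg : g < 8) (hf : Comp f) (hF : Comp fun E x => F E (stail (stail x)) (x 0) (x 1)) :
    Comp fun E x => loop (E.reg g) (f E x) (F E x) := by
  obtain ⟨S, hS, hf⟩ := hf
  obtain ⟨T, hT, hF⟩ := hF
  refine ⟨fun B => S B + (2 + (B * (T B + 10) + 10)), hS.add ((PolyBound.const 2).add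
    ((PolyBound.id.mul (hT.add (.const 10))).add (.const 10))), fun b ρ hb hρ => ?_⟩
  obtain ⟨p, hp⟩ := hf b ρ hb hρ
  obtain ⟨q, hq⟩ := hF (b + 2) (scons (b + 1) (scons b ρ)) (by omega)
    (scons_lt (by omega) (scons_lt (by omega) fun j => (hρ j).trans (by omega)))
  set body : Prog := .seq q (.seq (.assign b (.reg (b + 2)))
    (.assign (b + 1) (.add (.reg (b + 1)) (.const 1)))) with hbody
  refine ⟨.seq p (.seq (.assign (b + 1) (.const 0))
    (.while (.sub (.reg g) (.reg (b + 1))) body)), fun E x B σ h1 h2 h3 h4 => ?_⟩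
  have key : ∀ m i, i + m = E.reg g → ∀ τ, Frame b σ τ → τ.reg (b + 1) = i →
      τ.reg b = RAM.loop i (f E x) (F E x) →
      ∃ τ' t, Exec (.while (.sub (.reg g) (.reg (b + 1))) body) τ τ' t ∧ t ≤ m * (T B + 10) + 10 ∧
        Frame b σ τ' ∧ τ'.reg b = RAM.loop (E.reg g) (f E x) (F E x) := by
    intro m
    induction m with
    | zero =>
      intro i hi τ hτ h5 h6
      refine ⟨τ, _, .while_false ?_, ?_, hτ, ?_⟩
      · simp [Expr.eval, h5, (h3.trans hτ hb).1 g hg, ← hi]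
      · simp [Expr.time]
      · rw [h6, ← hi, add_zero]
    | succ m ih =>
      intro i hi τ hτ h5 h6
      obtain ⟨τ₁, t₁, e₁, l₁, f₁, v₁⟩ := hq E (scons i (scons (RAM.loop i (f E x) (F E x)) x)) B τ
        h1 h2 (h3.trans hτ hb) (by
          rintro (_ | _ | j)
          · exact h5
          · exact h6
          · exact (hτ.1 _ (hρ j)).trans (h4 j))
      obtain ⟨τ₂, t₂, e₂, l₂, f₂, v₂⟩ := ih (i + 1) (by omega)
        ((τ₁.setReg b (τ₁.reg (b + 2))).setReg (b + 1) (i + 1))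
        ((hτ.trans f₁ (by omega)).trans ((Frame.setReg _ _ le_rfl).trans
          (Frame.setReg _ _ (by omega)) le_rfl) le_rfl) (by simp) (by
          rw [State.setReg_reg_of_ne _ _ (by omega), State.setReg_reg_self, v₁, loop_succ]; rfl)
      refine ⟨τ₂, _, .while_true ?_ (.seq e₁ (.seq (.assign _ _ _) (.assign _ _ _))) (t₂ := t₂) ?_,
        ?_, f₂, v₂⟩
      · simp only [Expr.eval, h5, (h3.trans hτ hb).1 g hg, ← hi]; omega
      · convert e₂ using 2
        · rfl
        change (State.setReg _ b _).reg (b + 1) + 1 = i + 1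
        rw [State.setReg_reg_of_ne _ _ (by omega), f₁.1 _ (by omega), h5]
      · simp only [Expr.time]
        have : (m + 1) * (T B + 10) = m * (T B + 10) + (T B + 10) := by ring
        omega
  obtain ⟨σ₁, t₁, e₁, l₁, f₁, v₁⟩ := hp E x B σ h1 h2 h3 h4
  obtain ⟨σ₂, t₂, e₂, l₂, f₂, v₂⟩ := key (E.reg g) 0 (by omega) (σ₁.setReg (b + 1) 0)
    (f₁.trans (Frame.setReg _ _ (by omega)) le_rfl) (by simp)
    (by rw [State.setReg_reg_of_ne _ _ (by omega), v₁]; rfl)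
  refine ⟨σ₂, _, .seq e₁ (.seq (.assign _ _ _) e₂), ?_, f₂, v₂⟩
  have : E.reg g * (T B + 10) ≤ B * (T B + 10) := Nat.mul_le_mul_right _ (h2 g hg)
  simp only [Expr.time]; omega

open Finset

namespace Comp

variable {f g h : State → (ℕ → ℕ) → ℕ}

theorem sum {F : State → (ℕ → ℕ) → ℕ → ℕ} (r : ℕ) (hr : r < 8)
    (hF : Comp fun E x => F E (stail x) (x 0)) :
    Comp fun E x => ∑ i ∈ range (E.reg r), F E x i := by
  refine (Comp.loop (F := fun E x i acc => acc + F E x i) r hr (.const 0)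
    ((var 1).add (hF.rename fun | 0 => 0 | j + 1 => j + 2))).congr fun E x => ?_
  generalize E.reg r = n
  induction n with
  | zero => rfl
  | succ n ih => rw [loop_succ, ih, sum_range_succ]

/-- The machine cannot multiply; the product is a repeated addition. -/
theorem mulReg (r : ℕ) (hr : r < 8) (hf : Comp f) : Comp fun E x => f E x * E.reg r :=
  (sum (F := fun E x _ => f E x) r hr (hf.rename Nat.succ)).congr fun E x => by simp [mul_comm]

end Comp

namespace CompP

variable {P Q : State → (ℕ → ℕ) → Prop} {f g : State → (ℕ → ℕ) → ℕ}

theorem of_iff (hP : CompP P) (h : ∀ E x, P E x ↔ Q E x) : CompP Q := by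
  obtain ⟨f, hf, hf'⟩ := hP
  exact ⟨f, hf, fun E x => (hf' E x).trans (h E x)⟩

theorem rename (hP : CompP P) (π : ℕ → ℕ) : CompP fun E x => P E fun j => x (π j) := by
  obtain ⟨f, hf, hf'⟩ := hP
  exact ⟨_, hf.rename π, fun E x => hf' E _⟩

theorem let_ (hf : Comp f) (hP : CompP P) : CompP fun E x => P E (scons (f E x) x) := by
  obtain ⟨g, hg, hg'⟩ := hP
  exact ⟨_, hf.let_ hg, fun E x => hg' E _⟩

theorem comp₁ {R : State → ℕ → Prop} (hR : CompP fun E x => R E (x 0)) (hf : Comp f) :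
    CompP fun E x => R E (f E x) := let_ hf hR

theorem comp₂ {R : State → ℕ → ℕ → Prop} (hR : CompP fun E x => R E (x 0) (x 1)) (hf : Comp f)
    (hg : Comp g) : CompP fun E x => R E (f E x) (g E x) :=
  let_ hf (let_ (hg.rename Nat.succ) (hR.rename fun | 0 => 1 | 1 => 0 | j => j))

theorem comp₃ {R : State → ℕ → ℕ → ℕ → Prop} {h : State → (ℕ → ℕ) → ℕ}
    (hR : CompP fun E x => R E (x 0) (x 1) (x 2)) (hf : Comp f) (hg : Comp g) (hh : Comp h) :
    CompP fun E x => R E (f E x) (g E x) (h E x) :=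
  let_ hf (let_ (hg.rename Nat.succ) (let_ (hh.rename (· + 2))
    (hR.rename fun | 0 => 2 | 1 => 1 | 2 => 0 | j => j)))

theorem comp₄ {R : State → ℕ → ℕ → ℕ → ℕ → Prop} {h l : State → (ℕ → ℕ) → ℕ}
    (hR : CompP fun E x => R E (x 0) (x 1) (x 2) (x 3)) (hf : Comp f) (hg : Comp g) (hh : Comp h)
    (hl : Comp l) : CompP fun E x => R E (f E x) (g E x) (h E x) (l E x) :=
  let_ hf (let_ (hg.rename Nat.succ) (let_ (hh.rename (· + 2)) (let_ (hl.rename (· + 3))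
    (hR.rename fun | 0 => 3 | 1 => 2 | 2 => 1 | 3 => 0 | j => j))))

theorem ne_zero (hf : Comp f) : CompP fun E x => f E x ≠ 0 := ⟨f, hf, fun _ _ => Iff.rfl⟩

theorem lt (hf : Comp f) (hg : Comp g) : CompP fun E x => f E x < g E x :=
  ⟨_, hg.sub hf, fun E x => by omega⟩

theorem le (hf : Comp f) (hg : Comp g) : CompP fun E x => f E x ≤ g E x :=
  ⟨_, (Comp.const 1).sub (hf.sub hg), fun E x => by omega⟩

theorem not (hP : CompP P) : CompP fun E x => ¬ P E x := by
  obtain ⟨f, hf, hf'⟩ := hP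
  exact ⟨_, (Comp.const 1).sub hf, fun E x => by have := hf' E x; dsimp only; rw [← this]; omega⟩

theorem or (hP : CompP P) (hQ : CompP Q) : CompP fun E x => P E x ∨ Q E x := by
  obtain ⟨f, hf, hf'⟩ := hP
  obtain ⟨g, hg, hg'⟩ := hQ
  exact ⟨_, hf.add hg, fun E x => by
    have := hf' E x; have := hg' E x; dsimp only; rw [← ‹_ ↔ P E x›, ← ‹_ ↔ Q E x›]; omega⟩

theorem and (hP : CompP P) (hQ : CompP Q) : CompP fun E x => P E x ∧ Q E x :=
  (hP.not.or hQ.not).not.of_iff fun E x => by tauto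

theorem imp (hP : CompP P) (hQ : CompP Q) : CompP fun E x => P E x → Q E x :=
  (hP.not.or hQ).of_iff fun E x => by tauto

theorem eq (hf : Comp f) (hg : Comp g) : CompP fun E x => f E x = g E x :=
  ((le hf hg).and (le hg hf)).of_iff fun E x => by omega

theorem ne (hf : Comp f) (hg : Comp g) : CompP fun E x => f E x ≠ g E x := (eq hf hg).not

theorem exists_lt {R : State → (ℕ → ℕ) → ℕ → Prop} (r : ℕ) (hr : r < 8)
    (hR : CompP fun E x => R E (stail x) (x 0)) : CompP fun E x => ∃ i < E.reg r, R E x i := by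
  obtain ⟨f, hf, hf'⟩ := hR
  -- A sum of natural numbers is nonzero exactly when some term is.
  refine ⟨_, Comp.sum (F := fun E x i => f E (scons i x)) r hr
    (hf.congr fun E x => ?_), fun E x => ?_⟩
  · congr 1; funext j; cases j <;> rfl
  · have : ∀ i, f E (scons i x) ≠ 0 ↔ R E x i := fun i => hf' E (scons i x)
    simp [Finset.sum_eq_zero_iff, ← this]

theorem forall_lt {R : State → (ℕ → ℕ) → ℕ → Prop} (r : ℕ) (hr : r < 8)
    (hR : CompP fun E x => R E (stail x) (x 0)) : CompP fun E x => ∀ i < E.reg r, R E x i :=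
  (exists_lt (R := fun E x i => ¬ R E x i) r hr hR.not).not.of_iff fun E x => by simp

theorem ite {inst : ∀ E x, Decidable (P E x)} {Q₁ Q₂ : State → (ℕ → ℕ) → Prop} (hP : CompP P)
    (h₁ : CompP Q₁) (h₂ : CompP Q₂) :
    CompP fun E x => @_root_.ite _ (P E x) (inst E x) (Q₁ E x) (Q₂ E x) :=
  ((hP.and h₁).or (hP.not.and h₂)).of_iff fun E x => by by_cases h : P E x <;> simp [h]

end CompP

/-- Loop bounds are registers; a computed bound is simulated by making the rounds from `m` on idle.
-/
theorem loop_ite_lt (n m a : ℕ) (F : ℕ → ℕ → ℕ) :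
    loop n a (fun i y => if i < m then F i y else y) = loop (min m n) a F := by
  induction n with
  | zero => simp
  | succ n ih =>
    rw [loop_succ, ih]
    split_ifs with h
    · rw [min_eq_right h.le, min_eq_right h, loop_succ]
    · rw [min_eq_left (by omega), min_eq_left (by omega)]

/-- A loop whose number of rounds is a computed value. -/
theorem Comp.loop_min {f m : State → (ℕ → ℕ) → ℕ} {F : State → (ℕ → ℕ) → ℕ → ℕ → ℕ} (r : ℕ)
    (hr : r < 8) (hm : Comp m) (hf : Comp f)
    (hF : Comp fun E x => F E (stail (stail x)) (x 0) (x 1)) :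
    Comp fun E x => RAM.loop (min (m E x) (E.reg r)) (f E x) (F E x) :=
  (Comp.loop (F := fun E x i y => if i < m E x then F E x i y else y) r hr hf
    (.ite (.lt (.var 0) (hm.rename (· + 2))) hF (.var 1))).congr fun _ _ => loop_ite_lt _ _ _ _

/-- Division by the register `r`, correct as long as the quotient is at most the register `4`. -/
def divReg (r : ℕ) (E : State) (y : ℕ) : ℕ :=
  ∑ i ∈ range (E.reg 4), if (i + 1) * E.reg r ≤ y then 1 else 0

theorem Comp.divReg (r : ℕ) (hr : r < 8) : Comp fun E x => divReg r E (x 0) :=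
  .sum (F := fun E x i => if (i + 1) * E.reg r ≤ x 0 then 1 else 0) 4 (by norm_num)
    (.ite (.le (.mulReg r hr ((Comp.var 0).add (.const 1))) (.var 1)) (.const 1) (.const 0))

/-- The summation counts the `i` with `i < y / E.reg r`. As `y ≤ E.reg 4`, none of them falls
outside the range. -/
theorem divReg_eq {r y : ℕ} {E : State} (hr : 0 < E.reg r) (hy : y ≤ E.reg 4) :
    divReg r E y = y / E.reg r := by
  have h : ∀ i, (i + 1) * E.reg r ≤ y ↔ i < y / E.reg r := fun i => by
    rw [← Nat.le_div_iff_mul_le hr]; rfl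
  have h2 := (Nat.div_le_self y (E.reg r)).trans hy
  simp only [divReg, h, Finset.sum_boole]
  rw [show (filter (fun i => i < y / E.reg r) (range (E.reg 4))) = range (y / E.reg r) by
    ext i; simp only [mem_filter, mem_range]; omega]
  simp

/-- Remainder modulo the register `r`. -/
def modReg (r : ℕ) (E : State) (y : ℕ) : ℕ := y - divReg r E y * E.reg r

theorem Comp.modReg (r : ℕ) (hr : r < 8) : Comp fun E x => modReg r E (x 0) :=
  (Comp.var 0).sub (.mulReg r hr (.divReg r hr))

theorem modReg_eq {r y : ℕ} {E : State} (hr : 0 < E.reg r) (hy : y ≤ E.reg 4) :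
    modReg r E y = y % E.reg r := by
  rw [modReg, divReg_eq hr hy, Nat.mod_eq_sub_div_mul]

/-! ### Sets of numbers below the register `0`, encoded as bit patterns -/

/-- `2 ^ min j n` for the register `0` holding `n`. -/
def twoPow (E : State) (j : ℕ) : ℕ := loop (min j (E.reg 0)) 1 fun _ y => y + y

theorem Comp.twoPow : Comp fun E x => twoPow E (x 0) :=
  .loop_min (F := fun _ _ _ y => y + y) 0 (by norm_num) (.var 0) (.const 1)
    ((Comp.var 1).add (.var 1))

theorem twoPow_eq {E : State} {j : ℕ} (hj : j ≤ E.reg 0) : twoPow E j = 2 ^ j := by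
  rw [twoPow, min_eq_left hj]
  clear hj
  induction j with
  | zero => rfl
  | succ j ih => rw [loop_succ, ih]; ring

open Classical in
/-- The bit pattern of a predicate on the numbers below `n`. -/
noncomputable def bits (n : ℕ) (P : ℕ → Prop) : ℕ := ∑ i ∈ range n, if P i then 2 ^ i else 0

open Classical in
theorem bits_congr {n : ℕ} {P Q : ℕ → Prop} (h : ∀ i < n, (P i ↔ Q i)) : bits n P = bits n Q := by
  unfold bits
  refine Finset.sum_congr rfl fun i hi => ?_
  exact if_congr (h i (mem_range.1 hi)) rfl rfl

theorem bits_lt (n : ℕ) (P : ℕ → Prop) : bits n P < 2 ^ n := by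
  induction n with
  | zero => simp [bits]
  | succ n ih =>
    rw [bits, sum_range_succ, ← bits, pow_succ]
    split_ifs <;> omega

/-- A function in `Comp` returns one number and writes no array, so a set of vertices is passed on
as a single number below `2 ^ n`. Unit cost makes this cheap. -/
theorem Comp.bits {P : State → (ℕ → ℕ) → ℕ → Prop} (hP : CompP fun E x => P E (stail x) (x 0)) :
    Comp fun E x => bits (E.reg 0) (P E x) := by
  classical
  refine (Comp.sum (F := fun E x i => if P E x i then RAM.twoPow E i else 0) 0 (by norm_num)
    (.ite hP .twoPow (.const 0))).congr fun E x => ?_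
  refine Finset.sum_congr rfl fun i hi => ?_
  rw [twoPow_eq (mem_range.1 hi).le]

/-- Removes the bits above bit `j` from a number below `2 ^ n`, the register `0` holding `n`. -/
def lowBits (E : State) (y j : ℕ) : ℕ :=
  loop (E.reg 0) y fun i z =>
    if j < E.reg 0 - 1 - i ∧ twoPow E (E.reg 0 - 1 - i) ≤ z then z - twoPow E (E.reg 0 - 1 - i)
    else z

theorem Comp.lowBits : Comp fun E x => lowBits E (x 0) (x 1) := by
  have h : Comp fun E x => RAM.twoPow E (E.reg 0 - 1 - x 0) :=
    .comp₁ .twoPow (((Comp.reg 0).sub (.const 1)).sub (.var 0))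
  refine .loop (F := fun E x i z => if x 1 < E.reg 0 - 1 - i ∧
    RAM.twoPow E (E.reg 0 - 1 - i) ≤ z then z - RAM.twoPow E (E.reg 0 - 1 - i) else z) 0
    (by norm_num) (.var 0) ?_
  exact .ite (.and (.lt (.var 3) (((Comp.reg 0).sub (.const 1)).sub (.var 0))) (.le h (.var 1)))
    ((Comp.var 1).sub h) (.var 1)

theorem lowBits_bits {E : State} (P : ℕ → Prop) {j : ℕ} (hj : j < E.reg 0) :
    lowBits E (bits (E.reg 0) P) j = bits (j + 1) P := by
  -- The powers are tried from the highest down. The bits below bit `m` sum to less than `2 ^ m`, so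
  -- comparison with `2 ^ m` reads off the top bit.
  have key : ∀ i, i ≤ E.reg 0 → loop i (bits (E.reg 0) P) (fun i z =>
      if j < E.reg 0 - 1 - i ∧ twoPow E (E.reg 0 - 1 - i) ≤ z then z - twoPow E (E.reg 0 - 1 - i)
      else z) = bits (max (E.reg 0 - i) (j + 1)) P := by
    intro i hi
    induction i with
    | zero => rw [loop_zero, max_eq_left (by omega)]; rfl
    | succ i ih =>
      rw [loop_succ, ih (by omega), twoPow_eq (by omega)]
      by_cases h : j < E.reg 0 - 1 - i
      · rw [max_eq_left (by omega), max_eq_left (by omega),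
          show E.reg 0 - i = (E.reg 0 - 1 - i) + 1 by omega,
          show E.reg 0 - (i + 1) = E.reg 0 - 1 - i by omega]
        generalize E.reg 0 - 1 - i = m at h
        have := bits_lt m P
        rw [bits, sum_range_succ, ← bits]
        split_ifs <;> (simp_all; try omega)
      · rw [if_neg (by tauto), max_eq_right (by omega), max_eq_right (by omega)]
  have := key (E.reg 0) le_rfl
  rwa [Nat.sub_self, max_eq_right (by omega)] at this

/-- Bit `j` of the number `y`. -/
def HasBit (E : State) (y j : ℕ) : Prop := twoPow E j ≤ lowBits E y j

theorem CompP.hasBit : CompP fun E x => HasBit E (x 0) (x 1) :=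
  .le (.comp₁ .twoPow (.var 1)) .lowBits

theorem hasBit_bits {E : State} (P : ℕ → Prop) {j : ℕ} (hj : j < E.reg 0) :
    HasBit E (bits (E.reg 0) P) j ↔ P j := by
  rw [HasBit, lowBits_bits P hj, twoPow_eq hj.le, bits, sum_range_succ, ← bits]
  have := bits_lt j P
  split_ifs <;> simp_all

/-- `b` is reached from `a` in at most `d` steps through numbers below `n`. -/
def Within (n : ℕ) (R : ℕ → ℕ → Prop) : ℕ → ℕ → ℕ → Prop
  | 0, a, b => a = b
  | d + 1, a, b => Within n R d a b ∨ ∃ c < n, Within n R d a c ∧ R c b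

/-- The set reached so far is the accumulator of a loop, and each round adds all successors.
Evaluating the recursion of `Within` separately for each vertex would take exponential time. -/
theorem CompP.within {R : State → (ℕ → ℕ) → ℕ → ℕ → Prop} {m f g : State → (ℕ → ℕ) → ℕ}
    (hR : CompP fun E x => R E (stail (stail x)) (x 1) (x 0)) (hm : Comp m) (hf : Comp f)
    (hg : Comp g) : CompP fun E x =>
      g E x < E.reg 0 ∧ Within (E.reg 0) (R E x) (min (m E x) (E.reg 0)) (f E x) (g E x) := by
  have hset : Comp fun E x => RAM.bits (E.reg 0)
      (Within (E.reg 0) (R E x) (min (m E x) (E.reg 0)) (f E x)) := by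
    refine (Comp.loop_min (F := fun E x _ y => RAM.bits (E.reg 0) fun b =>
      HasBit E y b ∨ ∃ c < E.reg 0, HasBit E y c ∧ R E x c b)
      (f := fun E x => RAM.bits (E.reg 0) fun b => f E x = b) 0 (by norm_num) hm
      (.bits (.eq (hf.rename Nat.succ) (.var 0))) (.bits (.or (.comp₂ .hasBit (.var 2) (.var 0))
        (.exists_lt (R := fun E x c => HasBit E (x 2) c ∧ R E (stail (stail (stail x))) c (x 0)) 0
          (by norm_num) (.and (.comp₂ .hasBit (.var 3) (.var 0)) ?_))))).congr fun E x => ?_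
    · exact hR.rename fun | 0 => 1 | 1 => 0 | j + 2 => j + 4
    · generalize min (m E x) (E.reg 0) = d
      induction d with
      | zero => rfl
      | succ d ih =>
        rw [loop_succ, ih]
        refine bits_congr fun b hb => ?_
        rw [hasBit_bits _ hb, Within]
        refine or_congr Iff.rfl (exists_congr fun c => and_congr_right fun hc => ?_)
        rw [hasBit_bits _ hc]
  refine ((CompP.lt hg (.reg 0)).and (.comp₂ .hasBit hset hg)).of_iff fun E x =>
    and_congr_right fun h => hasBit_bits _ h

/-! ### Programs that set registers and fill arrays. -/

theorem Agree.refl (E : State) : Agree E E := Frame.refl _ _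

/-- From every state that agrees with `E` the program leads, within time `t`, to a state that
agrees with `E'`. -/
def Leads (p : Prog) (t : ℕ) (E E' : State) : Prop :=
  ∀ σ, Agree E σ → ∃ σ' s, Exec p σ σ' s ∧ s ≤ t ∧ Agree E' σ'

theorem Leads.seq {p q : Prog} {s t : ℕ} {E₁ E₂ E₃ : State} (hp : Leads p s E₁ E₂)
    (hq : Leads q t E₂ E₃) : Leads (.seq p q) (s + t) E₁ E₃ := fun σ hσ => by
  obtain ⟨σ₁, s₁, e₁, l₁, a₁⟩ := hp σ hσ
  obtain ⟨σ₂, s₂, e₂, l₂, a₂⟩ := hq σ₁ a₁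
  exact ⟨σ₂, _, .seq e₁ e₂, Nat.add_le_add l₁ l₂, a₂⟩

theorem Comp.exists_leads_setReg {f : State → ℕ} (hf : Comp fun E _ => f E) (g : ℕ) (hg : g < 8) :
    ∃ p T, PolyBound T ∧ ∀ E B, 1 ≤ B → (∀ g < 8, E.reg g ≤ B) →
      Leads p (T B) E (E.setReg g (f E)) := by
  obtain ⟨T, hT, hf⟩ := hf
  obtain ⟨p, hp⟩ := hf 8 (fun _ => 0) le_rfl fun _ => by norm_num
  refine ⟨.seq p (.assign g (.reg 8)), fun B => T B + 2, hT.add (.const 2),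
    fun E B h1 h2 σ hσ => ?_⟩
  obtain ⟨σ₁, s₁, e₁, l₁, a₁, v₁⟩ := hp E (fun _ => σ.reg 0) B σ h1 h2 hσ fun _ => rfl
  refine ⟨_, _, .seq e₁ (.assign _ _ _), by simp only [Expr.time]; omega, fun r hr => ?_, ?_⟩
  · rcases eq_or_ne r g with rfl | h
    · simp [Expr.eval, v₁]
    · rw [State.setReg_reg_of_ne _ _ h, State.setReg_reg_of_ne _ _ h]
      exact (Frame.trans hσ a₁ le_rfl).1 r hr
  · exact (Frame.trans hσ a₁ le_rfl).2

/-- The state after the cells `i < m` of array `a` have been set to `f E' i` one after the other,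
where `E'` is the state before the assignment. -/
def tabulate (a : ℕ) (f : State → ℕ → ℕ) (E : State) : ℕ → State
  | 0 => E
  | m + 1 => (tabulate a f E m).setArr a m (f (tabulate a f E m) m)

@[simp] theorem tabulate_reg (a : ℕ) (f : State → ℕ → ℕ) (E : State) (m : ℕ) :
    (tabulate a f E m).reg = E.reg := by
  induction m with
  | zero => rfl
  | succ m ih => exact ih

theorem tabulate_arr_of_ne {a a' : ℕ} (f : State → ℕ → ℕ) (E : State) (m : ℕ) (h : a' ≠ a) :
    (tabulate a f E m).arr a' = E.arr a' := by
  induction m with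
  | zero => rfl
  | succ m ih => exact (Function.update_of_ne h ..).trans ih

/-- A cell is written once, so it keeps the value computed from the state in which only the cells
before it had been filled. -/
theorem tabulate_arr_self {a i m : ℕ} (f : State → ℕ → ℕ) (E : State) (h : i < m) :
    (tabulate a f E m).arr a i = f (tabulate a f E i) i := by
  induction m with
  | zero => omega
  | succ m ih =>
    rw [tabulate, State.setArr]
    simp only [Function.update_self]
    rcases eq_or_ne i m with rfl | h'
    · simp
    · rw [Function.update_of_ne h', ih (by omega)]

/-- Register `8` is the counter and the code of `f` works from register `9` on. Since `f` may read
the cells already written, this is the loop of a dynamic program. -/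
theorem Comp.exists_leads_tabulate {f : State → ℕ → ℕ} (hf : Comp fun E x => f E (x 0)) (a g : ℕ)
    (hg : g < 8) : ∃ p T, PolyBound T ∧ ∀ E B, 1 ≤ B → (∀ g < 8, E.reg g ≤ B) →
      Leads p (T B) E (tabulate a f E (E.reg g)) := by
  obtain ⟨T, hT, hf⟩ := hf
  obtain ⟨q, hq⟩ := hf 9 (fun _ => 8) (by norm_num) fun _ => by norm_num
  set body : Prog := .seq q (.seq (.store a (.reg 8) (.reg 9))
    (.assign 8 (.add (.reg 8) (.const 1)))) with hbody
  refine ⟨.seq (.assign 8 (.const 0)) (.while (.sub (.reg g) (.reg 8)) body),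
    fun B => 2 + (B * (T B + 20) + 10), (PolyBound.const 2).add
      ((PolyBound.id.mul (hT.add (.const 20))).add (.const 10)), fun E B h1 h2 σ hσ => ?_⟩
  have key : ∀ m i, i + m = E.reg g → ∀ τ, Agree (tabulate a f E i) τ → τ.reg 8 = i →
      ∃ τ' t, Exec (.while (.sub (.reg g) (.reg 8)) body) τ τ' t ∧ t ≤ m * (T B + 20) + 10 ∧
        Agree (tabulate a f E (E.reg g)) τ' := by
    intro m
    induction m with
    | zero =>
      intro i hi τ hτ h8
      refine ⟨τ, _, .while_false ?_, by simp [Expr.time], ?_⟩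
      · have := hτ.1 g hg
        rw [tabulate_reg] at this
        simp only [Expr.eval]
        omega
      · rwa [← hi]
    | succ m ih =>
      intro i hi τ hτ h8
      have hEg := hτ.1 g hg
      rw [tabulate_reg] at hEg
      obtain ⟨τ₁, t₁, e₁, l₁, f₁, v₁⟩ := hq (tabulate a f E i) (fun _ => i) B τ h1
        (by simpa using h2) hτ fun _ => h8
      have h8' : τ₁.reg 8 = i := (f₁.1 8 (by norm_num)).trans h8
      have hτ₁ := hτ.trans f₁ (by norm_num)
      obtain ⟨τ₂, t₂, e₂, l₂, f₂⟩ := ih (i + 1) (by omega)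
        ((τ₁.setArr a i (τ₁.reg 9)).setReg 8 (i + 1)) (by
          refine ⟨fun r hr => ?_, ?_⟩
          · rw [State.setReg_reg_of_ne _ _ (by omega)]
            exact hτ₁.1 r hr
          · rw [State.setReg_arr]
            simp only [tabulate, State.setArr, hτ₁.2, v₁]) (by simp)
      refine ⟨τ₂, _, .while_true ?_ (.seq e₁ (.seq (.store _ _ _ _) (.assign _ _ _))) (t₂ := t₂) ?_,
        ?_, f₂⟩
      · simp only [Expr.eval]; omega
      · convert e₂ using 2
        · simp only [Expr.eval, h8']
        · change τ₁.reg 8 + 1 = i + 1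
          rw [h8']
      · simp only [Expr.time]
        have : (m + 1) * (T B + 20) = m * (T B + 20) + (T B + 20) := by ring
        omega
  obtain ⟨σ₁, t₁, e₁, l₁, a₁⟩ := key (E.reg g) 0 (by omega) (σ.setReg 8 0)
    (hσ.trans (Frame.setReg _ _ le_rfl) le_rfl) (by simp)
  refine ⟨σ₁, _, .seq (.assign _ _ _) e₁, ?_, a₁⟩
  have : E.reg g * (T B + 20) ≤ B * (T B + 20) := Nat.mul_le_mul_right _ (h2 g hg)
  simp only [Expr.time]; omega

end RAM

/-! ### Simple paths. -/

namespace CCMAR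

open Relation

/-- `p` is a walk without repeated terms from `s` to `t`, each step of which is in `R`. -/
def SimplePath {V : Type*} (R : V → V → Prop) (s t : V) (p : List V) : Prop :=
  p.Nodup ∧ p.IsChain R ∧ p.head? = some s ∧ p.getLast? = some t

theorem traverses_iff {V : Type*} {p : List V} {a b : V} :
    Traverses p a b ↔ ∃ (i : ℕ) (h : i + 1 < p.length), p[i] = a ∧ p[i + 1] = b := by
  constructor
  · rintro ⟨l₁, l₂, rfl⟩
    exact ⟨l₁.length, by simp, by simp, by simp⟩
  · rintro ⟨i, h, rfl, rfl⟩
    refine ⟨p.take i, p.drop (i + 2), ?_⟩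
    rw [List.append_assoc]
    conv_rhs => rw [← List.take_append_drop i p]
    rw [List.drop_eq_getElem_cons (show i < p.length by omega), List.drop_eq_getElem_cons h]
    rfl

theorem SimplePath.imp {V : Type*} {R R' : V → V → Prop} {s t : V} {p : List V}
    (h : SimplePath R s t p) (hR : ∀ a b, Traverses p a b → R a b → R' a b) :
    SimplePath R' s t p := by
  refine ⟨h.1, ?_, h.2.2⟩
  rw [List.isChain_iff_getElem]
  intro i hi
  exact hR _ _ (traverses_iff.2 ⟨i, hi, rfl, rfl⟩) (h.2.1.getElem i hi)

theorem SimplePath.of_traverses {V : Type*} {R : V → V → Prop} {s t a b : V} {p : List V}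
    (h : SimplePath R s t p) (hab : Traverses p a b) : R a b := by
  have := h.2.1.infix hab
  simpa using this

theorem SimplePath.traverses {V : Type*} {R : V → V → Prop} {s t : V} {p : List V}
    (h : SimplePath R s t p) : SimplePath (Traverses p) s t p :=
  h.imp fun _ _ hab _ => hab

theorem SimplePath.reach {V : Type*} {R : V → V → Prop} {s t : V} {p : List V}
    (h : SimplePath R s t p) : ReflTransGen R s t := by
  obtain ⟨-, hc, hs, ht⟩ := h
  induction p generalizing s with
  | nil => simp at hs
  | cons a l ih =>
    obtain rfl : a = s := by simpa using hs
    cases l with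
    | nil =>
      obtain rfl : a = t := by simpa using ht
      exact .refl
    | cons b l =>
      rw [List.isChain_cons_cons] at hc
      exact .head hc.1 (ih hc.2 rfl (by simpa using ht))

theorem exists_simplePath {V : Type*} {R : V → V → Prop} {s t : V} (h : ReflTransGen R s t) :
    ∃ p, SimplePath R s t p := by
  induction h using ReflTransGen.head_induction_on with
  | refl => exact ⟨[t], by simp, by simp, by simp, by simp⟩
  | @head a b hab _ ih =>
    obtain ⟨p, hn, hc, hs, ht⟩ := ih
    -- If the new first vertex already lies on the path, the loop is cut off instead.
    by_cases ha : a ∈ p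
    · obtain ⟨l₁, l₂, rfl⟩ := List.append_of_mem ha
      refine ⟨a :: l₂, hn.of_append_right, hc.right_of_append, rfl, ?_⟩
      simpa using ht
    · refine ⟨a :: p, List.nodup_cons.2 ⟨ha, hn⟩, hc.cons ?_, rfl, ?_⟩
      · intro y hy
        rw [hs] at hy
        obtain rfl : b = y := by simpa using hy
        exact hab
      · cases p with
        | nil => simp at hs
        | cons c l => simpa using ht

/-- The splitting of a simple path at one of its steps. -/
theorem SimplePath.split {V : Type*} {R : V → V → Prop} {s t u v : V} {p : List V}
    (h : SimplePath R s t p) (huv : Traverses p u v) :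
    ∃ l₁ l₂, p = (l₁ ++ [u]) ++ (v :: l₂) ∧ SimplePath R s u (l₁ ++ [u]) ∧
      SimplePath R v t (v :: l₂) ∧ v ∉ l₁ ++ [u] ∧ u ∉ v :: l₂ := by
  obtain ⟨l₁, l₂, rfl⟩ := huv
  have e : l₁ ++ [u, v] ++ l₂ = (l₁ ++ [u]) ++ (v :: l₂) := by simp
  rw [e] at h ⊢
  obtain ⟨hn, hc, hs, ht⟩ := h
  have hd := List.nodup_append.1 hn
  refine ⟨l₁, l₂, rfl, ⟨hn.of_append_left, hc.left_of_append, ?_, by simp⟩,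
    ⟨hn.of_append_right, hc.right_of_append, rfl, ?_⟩, ?_, ?_⟩
  · cases l₁ <;> simpa using hs
  · simpa using ht
  · intro hv
    exact hd.2.2 v hv v (by simp) rfl
  · intro hu
    exact hd.2.2 u (by simp) u hu rfl

theorem not_traverses_symm {V : Type*} {p : List V} {a b : V} (hp : p.Nodup)
    (hab : Traverses p a b) : ¬ Traverses p b a := by
  intro hba
  obtain ⟨i, hi, rfl, rfl⟩ := traverses_iff.1 hab
  obtain ⟨j, hj, h1, h2⟩ := traverses_iff.1 hba
  rw [hp.getElem_inj_iff] at h1 h2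
  omega

end CCMAR

/-! ### Rerouting along cycles, and forced steps in reduced relations. -/

namespace CCMAR

open Relation

variable {V : Type*}

theorem _root_.Relation.ReflTransGen.weaken {r s : V → V → Prop} {a b : V}
    (h : ReflTransGen r a b) (hrs : ∀ a b, r a b → s a b) : ReflTransGen s a b := by
  induction h with
  | refl => exact .refl
  | tail _ h ih => exact ih.tail (hrs _ _ h)

/-- The relation `S` without the pair `(u, v)`. -/
def Without (S : V → V → Prop) (u v a b : V) : Prop := S a b ∧ ¬ (a = u ∧ b = v)

/-- If `S` contains a simple cycle through the step from `v` to `u`, then the opposite step can be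
avoided: all walks can be rerouted along the cycle so that no new pair of opposite steps arises. -/
theorem exists_reroute {ι : Type*} {S : V → V → Prop} {u v : V} (huv : u ≠ v) (hvu : S v u)
    (hr : ReflTransGen (Without S u v) u v) (s t : ι → V) (U : ι → V → V → Prop)
    (hUS : ∀ i a b, U i a b → S a b) (hU : ∀ i, ReflTransGen (U i) (s i) (t i)) :
    ∃ U' : ι → V → V → Prop, (∀ i a b, U' i a b → Without S u v a b) ∧
      (∀ i, ReflTransGen (U' i) (s i) (t i)) ∧
      ∀ i j a b, U' i a b → U' j b a → U i a b ∧ U j b a := by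
  obtain ⟨q, hq⟩ := exists_simplePath hr
  -- The directed cycle consisting of `q` and the closing step from `v` to `u`.
  set F : V → V → Prop := fun a b => Traverses q a b ∨ (a = v ∧ b = u) with hF
  have hFS : ∀ a b, F a b → Without S u v a b := by
    rintro a b (h | ⟨rfl, rfl⟩)
    · exact hq.of_traverses h
    · exact ⟨hvu, fun h => huv h.2⟩
  -- No two steps of the cycle are opposite, because `q` is simple and does not take the step from
  -- `u` to `v`.
  have hanti : ∀ a b, F a b → ¬ F b a := by
    rintro a b (h | ⟨rfl, rfl⟩) (h' | ⟨h1, h2⟩)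
    · exact not_traverses_symm hq.1 h h'
    · exact (hq.of_traverses h).2 ⟨h2, h1⟩
    · exact (hq.of_traverses h').2 ⟨rfl, rfl⟩
    · exact huv h1
  have hq' : ReflTransGen F u v := hq.traverses.reach.weaken fun _ _ h => .inl h
  -- Going round the cycle replaces the reverse of any of its steps.
  have hback : ∀ a b, F a b → ReflTransGen F b a := by
    rintro a b (h | ⟨rfl, rfl⟩)
    · obtain ⟨l₁, l₂, hp, h1, h2, -, -⟩ := hq.traverses.split h
      exact (h2.reach.weaken fun _ _ h => .inl h).trans
        (.head (.inr ⟨rfl, rfl⟩) (h1.reach.weaken fun _ _ h => .inl h))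
    · exact hq'
  -- Every agent gives up the reverses of cycle steps, among them `u → v`, and gains the whole
  -- cycle. No cycle step belongs to an opposite pair, since its reverse is neither kept by any
  -- agent nor in the cycle.
  refine ⟨fun i a b => (U i a b ∧ ¬ F b a) ∨ F a b, ?_, ?_, ?_⟩
  · rintro i a b (⟨h, h'⟩ | h)
    · exact ⟨hUS i a b h, fun hab => h' (.inr ⟨hab.2, hab.1⟩)⟩
    · exact hFS a b h
  · intro i
    have h := hU i
    generalize t i = z at h
    induction h with
    | refl => exact .refl
    | @tail b c _ hbc ih =>
      refine ih.trans ?_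
      by_cases h : F c b
      · exact (hback c b h).weaken fun _ _ h => .inr h
      · exact .single (.inl ⟨hbc, h⟩)
  · rintro i j a b (⟨h1, h2⟩ | h) (⟨h3, h4⟩ | h')
    · exact ⟨h1, h3⟩
    · exact absurd h' h2
    · exact absurd h h4
    · exact absurd h' (hanti a b h)

/-- The steps of `S` that avoid the vertex `z`. -/
def Avoid (S : V → V → Prop) (z a b : V) : Prop := S a b ∧ a ≠ z ∧ b ≠ z

/-- Cut the walk after its last visit to `u`. If the rest takes the step to `v` at all, it does so
at once and never meets `u` again. -/
theorem reach_without_or_avoid {S : V → V → Prop} {u v z : V}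
    (h : ReflTransGen S u z) : ReflTransGen (Without S u v) u z ∨
      (ReflTransGen (Avoid S u) v z ∧ z ≠ u) := by
  induction h with
  | refl => exact .inl .refl
  | @tail b c _ hbc ih =>
    by_cases hc : c = u
    · exact .inl (hc ▸ .refl)
    rcases ih with ih | ⟨ih, hb⟩
    · by_cases h : b = u ∧ c = v
      · exact .inr ⟨h.2 ▸ .refl, hc⟩
      · exact .inl (ih.tail ⟨hbc, h⟩)
    · exact .inr ⟨ih.tail ⟨hbc, hb, hc⟩, hc⟩

/-- The mirror image: the walk is cut at its first visit to `v`. -/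
theorem without_or_avoid_reach {S : V → V → Prop} {u v z : V}
    (h : ReflTransGen S z v) : ReflTransGen (Without S u v) z v ∨
      (ReflTransGen (Avoid S v) z u ∧ z ≠ v) := by
  induction h using ReflTransGen.head_induction_on with
  | refl => exact .inl .refl
  | @head b c hbc _ ih =>
    by_cases hb : b = v
    · exact .inl (hb ▸ .refl)
    rcases ih with ih | ⟨ih, hc⟩
    · by_cases h : b = u ∧ c = v
      · exact .inr ⟨h.1 ▸ .refl, hb⟩
      · exact .inl (.head ⟨hbc, h⟩ ih)
    · exact .inr ⟨.head ⟨hbc, hb, hc⟩ ih, hb⟩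

/-- No step of `S` whose opposite belongs to `S` lies on a cycle of length at least three. -/
def Reduced (S : V → V → Prop) : Prop :=
  ∀ u v, u ≠ v → S u v → S v u → ¬ ReflTransGen (Without S u v) u v

theorem SimplePath.avoid {S : V → V → Prop} {s t z : V} {p : List V} (h : SimplePath S s t p)
    (hz : z ∉ p) : ReflTransGen (Avoid S z) s t := by
  refine (h.imp (R' := Avoid S z) fun a b hab hS => ⟨hS, ?_, ?_⟩).reach
  · rintro rfl; exact hz (hab.subset (by simp))
  · rintro rfl; exact hz (hab.subset (by simp))

/-- The path splits into a part from `x` to `u` avoiding `v` and a part from `v` to `y` avoiding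
`u`. If `u` could return to `x` only through `u → v`, there would be a walk from `v` to `x` avoiding
`u`; continued to `u` by the first part it would avoid `v → u`, against reducedness for that step.
So `u` reaches `x`, and likewise `y` reaches `v`, without `u → v`. A walk from `x` to `y` without `u
→ v` would then close a walk from `u` to `v`, against reducedness for `u → v`. -/
theorem Reduced.not_reach {S : V → V → Prop} (hS : Reduced S) {x y u v : V} {p : List V}
    (hp : SimplePath S x y p) (hyx : ReflTransGen S y x) (huv : Traverses p u v) (hvu : S v u) :
    ¬ ReflTransGen (Without S u v) x y := by
  intro hW
  obtain ⟨l₁, l₂, rfl, h1, h2, hv, hu⟩ := hp.split huv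
  have hne : u ≠ v := by rintro rfl; exact hu (by simp)
  have hSuv := hp.of_traverses huv
  have a1 := h1.avoid hv
  have a2 := h2.avoid hu
  have w1 : ∀ a b, Avoid S v a b → Without S v u a b := fun a b h => ⟨h.1, fun h' => h.2.1 h'.1⟩
  have w2 : ∀ a b, Avoid S u a b → Without S v u a b := fun a b h => ⟨h.1, fun h' => h.2.2 h'.2⟩
  have hux : ReflTransGen (Without S u v) u x := by
    refine (reach_without_or_avoid ((ReflTransGen.head hSuv h2.reach).trans hyx)).resolve_right
      fun h => hS v u hne.symm hvu hSuv ((h.1.weaken w2).trans (a1.weaken w1))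
  have hyv : ReflTransGen (Without S u v) y v := by
    refine (without_or_avoid_reach (hyx.trans (h1.reach.tail hSuv))).resolve_right
      fun h => hS v u hne.symm hvu hSuv ((a2.weaken w2).trans (h.1.weaken w1))
  exact hS u v hne hSuv hvu (hux.trans (hW.trans hyv))

/-! ### Schedules through the strong components. -/

/-- Level `r` of a schedule: an agent on a vertex `p` of rank `r` walks to a vertex `q` of the same
strong component, where it stops, or from which it steps to a vertex `p'` of smaller rank; all other
agents do not move. -/
def Moves (S : V → V → Prop) (rk : V → ℕ) (t : V) (r : ℕ) (p q p' : V) : Prop :=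
  (rk p = r → ReflTransGen S p q ∧ ReflTransGen S q p ∧
    ((q = t ∧ p' = t) ∨ (S q p' ∧ rk p' < r))) ∧ (rk p ≠ r → q = p ∧ p' = p)

/-- A function that decreases along `S`, strictly except within strong components. -/
structure IsRank (S : V → V → Prop) (rk : V → ℕ) : Prop where
  le : ∀ a b, S a b → rk b ≤ rk a
  reach : ∀ a b, ReflTransGen S a b → rk a = rk b → ReflTransGen S b a

theorem IsRank.le_of_reach {S : V → V → Prop} {rk : V → ℕ} (h : IsRank S rk) {a b : V}
    (hab : ReflTransGen S a b) : rk b ≤ rk a := by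
  induction hab with
  | refl => exact le_rfl
  | tail _ hbc ih => exact (h.le _ _ hbc).trans ih

/-- Follow the walk until the rank drops for the first time, or to its end if it never drops. -/
theorem IsRank.exists_leave {S U : V → V → Prop} {rk : V → ℕ} (h : IsRank S rk)
    (hUS : ∀ a b, U a b → S a b) {p t : V} (hpt : ReflTransGen U p t) :
    ∃ q, ReflTransGen U p q ∧ rk q = rk p ∧
      (q = t ∨ ∃ p', U q p' ∧ rk p' < rk p ∧ ReflTransGen U p' t) := by
  induction hpt using ReflTransGen.head_induction_on with
  | refl => exact ⟨t, .refl, rfl, .inl rfl⟩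
  | @head a b hab hbt ih =>
    obtain ⟨q, h1, h2, h3⟩ := ih
    rcases (h.le _ _ (hUS _ _ hab)).lt_or_eq with hlt | heq
    · exact ⟨a, .refl, rfl, .inr ⟨b, hab, hlt, hbt⟩⟩
    · exact ⟨q, .head hab h1, h2.trans heq, heq ▸ h3⟩

/-- The walk is cut where its rank drops. The invariant is `rk p ≤ r ∨ p = t`: an agent stopped at
its target waits there on all lower levels. On level `0` the positivity of the ranks leaves only `p
= t`. -/
theorem IsRank.exists_schedule {S U : V → V → Prop} {rk : V → ℕ} (h : IsRank S rk)
    (hUS : ∀ a b, U a b → S a b) {t : V} (r : ℕ) (hpos : ∀ p, ReflTransGen U p t → 0 < rk p)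
    (p : V) (hpt : ReflTransGen U p t) (hr : rk p ≤ r ∨ p = t) :
    ∃ P Q : ℕ → V, P r = p ∧ P 0 = t ∧ (∀ l < r, Moves S rk t (l + 1) (P (l + 1)) (Q (l + 1)) (P l)) ∧
      ∀ l, ReflTransGen U p (P l) ∧ ReflTransGen U (P l) (Q l) := by
  induction r generalizing p with
  | zero =>
    have := hpos p hpt
    obtain rfl : p = t := hr.resolve_left (by omega)
    exact ⟨fun _ => p, fun _ => p, rfl, rfl, by simp, fun _ => ⟨.refl, .refl⟩⟩
  | succ r ih =>
    have hstep : ∃ q p', Moves S rk t (r + 1) p q p' ∧ ReflTransGen U p q ∧ ReflTransGen U q p' ∧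
        ReflTransGen U p' t ∧ (rk p' ≤ r ∨ p' = t) := by
      by_cases hp : rk p = r + 1
      · obtain ⟨q, h1, h2, h3⟩ := h.exists_leave hUS hpt
        have hpq := h1.weaken hUS
        have hqp := h.reach _ _ hpq h2.symm
        rcases h3 with rfl | ⟨p', h3, h4, h5⟩
        · exact ⟨q, q, ⟨fun _ => ⟨hpq, hqp, .inl ⟨rfl, rfl⟩⟩, fun h => absurd hp h⟩, h1, .refl, .refl,
            .inr rfl⟩
        · exact ⟨q, p', ⟨fun _ => ⟨hpq, hqp, .inr ⟨hUS _ _ h3, by omega⟩⟩, fun h => absurd hp h⟩, h1,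
            .single h3, h5, .inl (by omega)⟩
      · exact ⟨p, p, ⟨fun h => absurd h hp, fun _ => ⟨rfl, rfl⟩⟩, .refl, .refl, hpt,
          hr.imp (fun h => by omega) id⟩
    obtain ⟨q, p', hm, h1, h2, h3, h4⟩ := hstep
    obtain ⟨P, Q, e1, e2, hP, hQ⟩ := ih p' h3 h4
    refine ⟨Function.update P (r + 1) p, Function.update Q (r + 1) q, by simp,
      by rw [Function.update_of_ne (by omega), e2], fun l hl => ?_, fun l => ?_⟩
    · rw [Function.update_of_ne (show l ≠ r + 1 by omega)]
      rcases eq_or_ne l r with rfl | hlr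
      · simpa [e1] using hm
      · rw [Function.update_of_ne (by omega), Function.update_of_ne (by omega)]
        exact hP l (by omega)
    · rcases eq_or_ne l (r + 1) with rfl | hlr
      · simpa using ⟨ReflTransGen.refl, h1⟩
      · rw [Function.update_of_ne hlr, Function.update_of_ne hlr]
        exact ⟨h1.trans (h2.trans (hQ l).1), (hQ l).2⟩

/-- The steps of `S` that an agent may take whose schedule enters and leaves the vertices of rank
`r` in `P r` and `Q r`. -/
def Allowed (S : V → V → Prop) (rk : V → ℕ) (P Q : ℕ → V) (a b : V) : Prop :=
  S a b ∧ (S b a → ¬ ReflTransGen (Without S a b) (P (rk a)) (Q (rk a)))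

/-- Inside a level, any simple path from entrance to exit will do: it stays on one rank, and by
`Reduced.not_reach` its steps with an opposite are forced. A step to a smaller rank has no opposite,
since the rank never grows along `S`. -/
theorem Reduced.reach_allowed {S : V → V → Prop} {rk : V → ℕ} (h : IsRank S rk) (hS : Reduced S)
    {t : V} {P Q : ℕ → V} (r : ℕ)
    (hP : ∀ l < r, Moves S rk t (l + 1) (P (l + 1)) (Q (l + 1)) (P l)) :
    ReflTransGen (Allowed S rk P Q) (P r) (P 0) := by
  induction r with
  | zero => exact .refl
  | succ r ih =>
    refine .trans ?_ (ih fun l hl => hP l (by omega))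
    obtain ⟨h1, h2⟩ := hP r (by omega)
    by_cases hp : rk (P (r + 1)) = r + 1
    · obtain ⟨hpq, hqp, h3⟩ := h1 hp
      have hrq : rk (Q (r + 1)) = r + 1 :=
        le_antisymm ((h.le_of_reach hpq).trans_eq hp) (hp.symm.trans_le (h.le_of_reach hqp))
      have hPQ : ReflTransGen (Allowed S rk P Q) (P (r + 1)) (Q (r + 1)) := by
        obtain ⟨p, hpath⟩ := exists_simplePath hpq
        refine (hpath.imp (R' := Allowed S rk P Q) fun a b hab hSab => ⟨hSab, fun hba => ?_⟩).reach
        obtain ⟨l₁, l₂, -, a1, a2, -, -⟩ := hpath.split hab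
        have ha : rk a = r + 1 := le_antisymm ((h.le_of_reach a1.reach).trans_eq hp)
          (hrq.symm.trans_le (h.le_of_reach (.head hSab a2.reach)))
        rw [ha]
        exact hS.not_reach hpath hqp hab hba
      refine hPQ.trans ?_
      rcases h3 with ⟨h3, h4⟩ | ⟨h3, h4⟩
      · rw [h3, h4]
      · refine .single ⟨h3, fun hba => ?_⟩
        have := h.le _ _ hba
        omega
    · rw [(h2 hp).2]

end CCMAR

namespace CCMAR

open RAM Finset

/-! ## The algorithm

Register `0` holds the number `n` of vertices, register `1` the number `k` of agents, register `2`
the number `(n * n) ^ k` of configurations, register `3` the number `n * n`. Array `6` is going to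
hold the reduced step relation, array `7` the table of the dynamic program. -/

namespace Alg

variable (E : State)

/-- The weight of the edge between two vertices, `0` if there is none. -/
def wgt (u v : ℕ) : ℕ := E.arr 0 (u * E.reg 0 + v)

/-- The steps of the instance. -/
def Step₀ (u v : ℕ) : Prop := wgt E u v ≠ 0 ∨ E.arr 1 (u * E.reg 0 + v) ≠ 0

/-- The steps that remain when the pairs of index below `m` have been treated. -/
def Cur (m u v : ℕ) : Prop :=
  u < E.reg 0 ∧ v < E.reg 0 ∧
    if u * E.reg 0 + v < m then E.arr 6 (u * E.reg 0 + v) ≠ 0 else Step₀ E u v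

/-- The pair `(u, v)` of index `m` is not to be deleted. -/
def Keep (m u v : ℕ) : Prop :=
  Cur E m u v ∧ ¬ (u ≠ v ∧ Cur E m v u ∧
    v < E.reg 0 ∧ Within (E.reg 0) (Without (Cur E m) u v) (E.reg 0) u v)

open Classical in
/-- The entry of array `6` at the index `m`. -/
noncomputable def keepEntry (m : ℕ) : ℕ := if Keep E m (divReg 0 E m) (modReg 0 E m) then 1 else 0

/-- The step relation in array `6`. -/
def Red (u v : ℕ) : Prop := u < E.reg 0 ∧ v < E.reg 0 ∧ E.arr 6 (u * E.reg 0 + v) ≠ 0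

/-- Reachability along the steps in array `6`. -/
def Reach (u v : ℕ) : Prop := v < E.reg 0 ∧ Within (E.reg 0) (Red E) (E.reg 0) u v

open Classical in
/-- The number of vertices reachable from `v`. -/
noncomputable def rank (v : ℕ) : ℕ := ∑ w ∈ range (E.reg 0), if Reach E v w then 1 else 0

/-- There is no walk from `p` to `q` that avoids the step from `u` to `v`. -/
def Forced (p q u v : ℕ) : Prop :=
  ¬ (q < E.reg 0 ∧ Within (E.reg 0) (Without (Red E) u v) (E.reg 0) p q)

/-- Digit `i` of the configuration `c` to the base `n * n`, together with the higher digits. -/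
def cell (c i : ℕ) : ℕ := loop (min i (E.reg 1)) c fun _ y => divReg 3 E y

/-- The vertex where agent `i` enters the present level. -/
def pos (c i : ℕ) : ℕ := modReg 0 E (cell E c i)

/-- The vertex where agent `i` leaves the present level. -/
def ext (c i : ℕ) : ℕ := modReg 0 E (divReg 0 E (cell E c i))

open Classical in
/-- The cost of the level `r` in the configuration `c`. -/
noncomputable def levelCost (r c : ℕ) : ℕ :=
  ∑ u ∈ range (E.reg 0), ∑ v ∈ range (E.reg 0), ∑ i ∈ range (E.reg 1), ∑ j ∈ range (E.reg 1),
    if rank E u = r ∧ Forced E (pos E c i) (ext E c i) u v ∧ Forced E (pos E c j) (ext E c j) v u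
    then wgt E u v else 0

/-- Possible moves of an agent with target `t` on the level `r`. -/
def Move (t r p q p' : ℕ) : Prop :=
  (rank E p = r → Reach E p q ∧ Reach E q p ∧
    ((q = t ∧ p' = t) ∨ (Red E q p' ∧ rank E p' < r))) ∧ (rank E p ≠ r → q = p ∧ p' = p)

/-- The configuration `c'` may follow after the configuration `c` on the level `r`. -/
def Trans (r c c' : ℕ) : Prop :=
  ∀ i < E.reg 1, Move E (E.arr 3 i) r (pos E c i) (ext E c i) (pos E c' i)

/-- The agents enter the configuration `c` at the vertices in array `a`. -/
def At (a c : ℕ) : Prop := ∀ i < E.reg 1, pos E c i = E.arr a i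

/-- The entry of the table for the level `l` and the configuration `c`. -/
def tbl (l c : ℕ) : ℕ := E.arr 7 (l * E.reg 2 + c)

open Classical in
/-- One more than a configuration in `P` with the least nonzero entry on the level `l`; `0` if there
is none. -/
noncomputable def best (P : ℕ → Prop) (l : ℕ) : ℕ :=
  loop (E.reg 2) 0 fun c b =>
    if P c ∧ tbl E l c ≠ 0 ∧ (b = 0 ∨ tbl E l c < tbl E l (b - 1)) then c + 1 else b

open Classical in
/-- The entry of the table for the level `l` and the configuration `c`, computed from the level
below: `0` if the targets cannot be reached, otherwise one more than the least cost. -/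
noncomputable def entry (l c : ℕ) : ℕ :=
  if l = 0 then (if At E 3 c then 1 else 0)
  else if best E (Trans E l c) (l - 1) = 0 then 0
  else tbl E (l - 1) (best E (Trans E l c) (l - 1) - 1) + levelCost E l c

/-- The entry of array `7` at the index `y`. -/
noncomputable def tblEntry (y : ℕ) : ℕ := entry E (divReg 2 E y) (modReg 2 E y)

/-- The configuration on the level `n - j` of an optimal sequence of configurations. -/
noncomputable def traj (j : ℕ) : ℕ :=
  loop (min j (E.reg 0)) (best E (At E 2) (E.reg 0) - 1) fun j c =>
    best E (Trans E (E.reg 0 - j) c) (E.reg 0 - j - 1) - 1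

/-- The steps that the agent `i` may take. -/
def Allow (i a b : ℕ) : Prop :=
  Red E a b ∧ (Red E b a → Forced E (pos E (traj E (E.reg 0 - rank E a)) i)
    (ext E (traj E (E.reg 0 - rank E a)) i) a b)

open Classical in
/-- The distance of `v` to the target of the agent `i` along allowed steps. -/
noncomputable def dist (i v : ℕ) : ℕ :=
  ∑ d ∈ range (E.reg 0),
    if v < E.reg 0 ∧ Within (E.reg 0) (fun a b => Allow E i b a) (min d (E.reg 0)) (E.arr 3 i) v
    then 0 else 1

open Classical in
/-- The vertex after `u` on a shortest path of the agent `i`. -/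
noncomputable def next (i u : ℕ) : ℕ :=
  loop (E.reg 0) 0 fun v y => if Allow E i u v ∧ dist E i v + 1 = dist E i u then v else y

/-- The entry of array `5` at the index `x`. -/
noncomputable def pathEntry (x : ℕ) : ℕ :=
  if modReg 0 E x = 0 then E.arr 2 (divReg 0 E x) else next E (divReg 0 E x) (E.arr 5 (x - 1))

/-- The entry of array `4` at the index `i`. -/
noncomputable def lengthEntry (i : ℕ) : ℕ := dist E i (E.arr 2 i) + 1

/-! ### Polynomial-time computability of the quantities of the algorithm. -/

section

variable {f g h : State → (ℕ → ℕ) → ℕ}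

theorem comp_index (hf : Comp f) (hg : Comp g) : Comp fun E x => f E x * E.reg 0 + g E x :=
  (hf.mulReg 0 (by decide)).add hg

theorem comp_wgt : Comp fun E x => wgt E (x 0) (x 1) := .load 0 (comp_index (.var 0) (.var 1))

theorem compP_step₀ : CompP fun E x => Step₀ E (x 0) (x 1) :=
  (CompP.ne_zero comp_wgt).or (.ne_zero (.load 1 (comp_index (.var 0) (.var 1))))

theorem compP_within {R : State → (ℕ → ℕ) → ℕ → ℕ → Prop}
    (hR : CompP fun E x => R E (stail (stail x)) (x 1) (x 0)) (hf : Comp f) (hg : Comp g) :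
    CompP fun E x => g E x < E.reg 0 ∧ Within (E.reg 0) (R E x) (E.reg 0) (f E x) (g E x) :=
  (CompP.within hR (.reg 0) hf hg).of_iff fun E x => by rw [min_self]

theorem compP_cur : CompP fun E x => Cur E (x 0) (x 1) (x 2) :=
  (CompP.lt (.var 1) (.reg 0)).and ((CompP.lt (.var 2) (.reg 0)).and
    (.ite (.lt (comp_index (.var 1) (.var 2)) (.var 0))
      (.ne_zero (.load 6 (comp_index (.var 1) (.var 2)))) (.comp₂ compP_step₀ (.var 1) (.var 2))))

theorem compP_without {R : State → (ℕ → ℕ) → ℕ → ℕ → Prop}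
    (hR : CompP fun E x => R E (stail (stail x)) (x 1) (x 0)) (hf : Comp f) (hg : Comp g) :
    CompP fun E x => Without (R E (stail (stail x))) (f E (stail (stail x)))
      (g E (stail (stail x))) (x 1) (x 0) :=
  hR.and (((CompP.eq (.var 1) (hf.rename (· + 2))).and (.eq (.var 0) (hg.rename (· + 2)))).not)

theorem compP_keep : CompP fun E x => Keep E (x 0) (x 1) (x 2) := by
  refine (compP_cur).and (((CompP.ne (.var 1) (.var 2)).and
    ((CompP.comp₃ compP_cur (.var 0) (.var 2) (.var 1)).and (compP_within
      (R := fun E x => Without (Cur E (x 0)) (x 1) (x 2)) ?_ (.var 1) (.var 2)))).not)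
  exact compP_without (R := fun E x => Cur E (x 0)) (.comp₃ compP_cur (.var 2) (.var 1) (.var 0))
    (.var 1) (.var 2)

theorem comp_keepEntry : Comp fun E x => keepEntry E (x 0) :=
  .ite (.comp₃ compP_keep (.var 0) (.divReg 0 (by decide)) (.modReg 0 (by decide))) (.const 1)
    (.const 0)

theorem compP_red : CompP fun E x => Red E (x 0) (x 1) :=
  (CompP.lt (.var 0) (.reg 0)).and ((CompP.lt (.var 1) (.reg 0)).and
    (.ne_zero (.load 6 (comp_index (.var 0) (.var 1)))))

theorem compP_reach : CompP fun E x => Reach E (x 0) (x 1) :=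
  compP_within (R := fun E _ => Red E) (.comp₂ compP_red (.var 1) (.var 0)) (.var 0) (.var 1)

theorem comp_rank : Comp fun E x => rank E (x 0) := by
  classical
  exact .sum (F := fun E x w => if Reach E (x 0) w then 1 else 0) 0 (by decide)
    (.ite (.comp₂ compP_reach (.var 1) (.var 0)) (.const 1) (.const 0))

theorem compP_forced : CompP fun E x => Forced E (x 0) (x 1) (x 2) (x 3) :=
  (compP_within (R := fun E x => Without (Red E) (x 2) (x 3)) (compP_without
    (R := fun E _ => Red E) (.comp₂ compP_red (.var 1) (.var 0)) (.var 2) (.var 3)) (.var 0)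
    (.var 1)).not

theorem comp_cell : Comp fun E x => cell E (x 0) (x 1) :=
  .loop_min (F := fun E _ _ y => divReg 3 E y) 1 (by decide) (.var 1) (.var 0)
    (.comp₁ (.divReg 3 (by decide)) (.var 1))

theorem comp_pos : Comp fun E x => pos E (x 0) (x 1) := .comp₁ (.modReg 0 (by decide)) comp_cell

theorem comp_ext : Comp fun E x => ext E (x 0) (x 1) :=
  .comp₁ (.modReg 0 (by decide)) (.comp₁ (.divReg 0 (by decide)) comp_cell)

theorem compP_forced_at (hc : Comp h) {i : State → (ℕ → ℕ) → ℕ} (hi : Comp i) (hf : Comp f)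
    (hg : Comp g) : CompP fun E x => Forced E (pos E (h E x) (i E x)) (ext E (h E x) (i E x))
      (f E x) (g E x) :=
  .comp₄ compP_forced (.comp₂ comp_pos hc hi) (.comp₂ comp_ext hc hi) hf hg

theorem comp_levelCost : Comp fun E x => levelCost E (x 0) (x 1) := by
  classical
  refine .sum (F := fun E x u => ∑ v ∈ range (E.reg 0), ∑ i ∈ range (E.reg 1),
    ∑ j ∈ range (E.reg 1), if rank E u = x 0 ∧ Forced E (pos E (x 1) i) (ext E (x 1) i) u v ∧
      Forced E (pos E (x 1) j) (ext E (x 1) j) v u then wgt E u v else 0) 0 (by decide) ?_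
  refine .sum (F := fun E x v => ∑ i ∈ range (E.reg 1),
    ∑ j ∈ range (E.reg 1), if rank E (x 0) = x 1 ∧
      Forced E (pos E (x 2) i) (ext E (x 2) i) (x 0) v ∧
      Forced E (pos E (x 2) j) (ext E (x 2) j) v (x 0) then wgt E (x 0) v else 0) 0 (by decide) ?_
  refine .sum (F := fun E x i => ∑ j ∈ range (E.reg 1), if rank E (x 1) = x 2 ∧
      Forced E (pos E (x 3) i) (ext E (x 3) i) (x 1) (x 0) ∧
      Forced E (pos E (x 3) j) (ext E (x 3) j) (x 0) (x 1) then wgt E (x 1) (x 0) else 0) 1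
      (by decide) ?_
  refine .sum (F := fun E x j => if rank E (x 2) = x 3 ∧
      Forced E (pos E (x 4) (x 0)) (ext E (x 4) (x 0)) (x 2) (x 1) ∧
      Forced E (pos E (x 4) j) (ext E (x 4) j) (x 1) (x 2) then wgt E (x 2) (x 1) else 0) 1
      (by decide) ?_
  exact .ite ((CompP.eq (.comp₁ comp_rank (.var 3)) (.var 4)).and
    ((compP_forced_at (.var 5) (.var 1) (.var 3) (.var 2)).and
      (compP_forced_at (.var 5) (.var 0) (.var 2) (.var 3))))
    (.comp₂ comp_wgt (.var 3) (.var 2)) (.const 0)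

theorem compP_move : CompP fun E x => Move E (x 0) (x 1) (x 2) (x 3) (x 4) :=
  have hr : CompP fun E x => rank E (x 2) = x 1 := .eq (.comp₁ comp_rank (.var 2)) (.var 1)
  (hr.imp ((CompP.comp₂ compP_reach (.var 2) (.var 3)).and
    ((CompP.comp₂ compP_reach (.var 3) (.var 2)).and
      (((CompP.eq (.var 3) (.var 0)).and (.eq (.var 4) (.var 0))).or
        ((CompP.comp₂ compP_red (.var 3) (.var 4)).and
          (.lt (.comp₁ comp_rank (.var 4)) (.var 1))))))).and
  (hr.not.imp ((CompP.eq (.var 3) (.var 2)).and (.eq (.var 4) (.var 2))))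

theorem compP_trans : CompP fun E x => Trans E (x 0) (x 1) (x 2) := by
  refine .forall_lt (R := fun E x i => Move E (E.arr 3 i) (x 0) (pos E (x 1) i) (ext E (x 1) i)
    (pos E (x 2) i)) 1 (by decide) ?_
  -- The computed arguments of `Move` are bound one at a time; the final renaming restores their
  -- order.
  exact .let_ (f := fun E x => E.arr 3 (x 0)) (.load 3 (.var 0))
    (.let_ (f := fun E x => pos E (x 3) (x 1)) (.comp₂ comp_pos (.var 3) (.var 1))
    (.let_ (f := fun E x => ext E (x 4) (x 2)) (.comp₂ comp_ext (.var 4) (.var 2))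
    (.let_ (f := fun E x => pos E (x 6) (x 3)) (.comp₂ comp_pos (.var 6) (.var 3))
      (compP_move.rename fun | 0 => 3 | 1 => 5 | 2 => 2 | 3 => 1 | 4 => 0 | j => j))))

theorem compP_at (a : ℕ) : CompP fun E x => At E a (x 0) :=
  .forall_lt (R := fun E x i => pos E (x 0) i = E.arr a i) 1 (by decide)
    (.eq (.comp₂ comp_pos (.var 1) (.var 0)) (.load a (.var 0)))

theorem comp_tbl : Comp fun E x => tbl E (x 0) (x 1) :=
  .load 7 (((Comp.var 0).mulReg 2 (by decide)).add (.var 1))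

theorem comp_best {P : State → (ℕ → ℕ) → ℕ → Prop} (hP : CompP fun E x => P E (stail x) (x 0))
    (hf : Comp f) : Comp fun E x => best E (P E x) (f E x) := by
  classical
  refine .loop (F := fun E x c b => if P E x c ∧ tbl E (f E x) c ≠ 0 ∧
    (b = 0 ∨ tbl E (f E x) c < tbl E (f E x) (b - 1)) then c + 1 else b) 2 (by decide) (.const 0) ?_
  have hf' := hf.rename (· + 2)
  have h1 : Comp fun E x => tbl E (f E (stail (stail x))) (x 0) := .comp₂ comp_tbl hf' (.var 0)
  exact .ite ((hP.rename fun | 0 => 0 | j + 1 => j + 2).and ((CompP.ne_zero h1).and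
    ((CompP.eq (.var 1) (.const 0)).or (.lt h1 (.comp₂ comp_tbl hf' ((Comp.var 1).sub (.const 1)))))))
    ((Comp.var 0).add (.const 1)) (.var 1)

theorem comp_entry : Comp fun E x => entry E (x 0) (x 1) := by
  have hb : Comp fun E x => best E (Trans E (x 0) (x 1)) (x 0 - 1) :=
    comp_best (P := fun E x => Trans E (x 0) (x 1)) (.comp₃ compP_trans (.var 1) (.var 2) (.var 0))
      ((Comp.var 0).sub (.const 1))
  exact .ite (.eq (.var 0) (.const 0)) (.ite (.comp₁ (compP_at 3) (.var 1)) (.const 1) (.const 0))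
    (.ite (.eq hb (.const 0)) (.const 0)
      ((Comp.comp₂ comp_tbl ((Comp.var 0).sub (.const 1)) (hb.sub (.const 1))).add comp_levelCost))

theorem comp_tblEntry : Comp fun E x => tblEntry E (x 0) :=
  .comp₂ comp_entry (.divReg 2 (by decide)) (.modReg 2 (by decide))

theorem comp_traj : Comp fun E x => traj E (x 0) := by
  refine .loop_min (F := fun E _ j c => best E (Trans E (E.reg 0 - j) c) (E.reg 0 - j - 1) - 1) 0
    (by decide) (.var 0) ((comp_best (P := fun E _ => At E 2) (compP_at 2) (.reg 0)).sub (.const 1))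
    (Comp.sub (comp_best (P := fun E x => Trans E (E.reg 0 - x 0) (x 1)) (.comp₃ compP_trans
      ((Comp.reg 0).sub (.var 1)) (.var 2) (.var 0))
      (((Comp.reg 0).sub (.var 0)).sub (.const 1))) (.const 1))

theorem compP_allow : CompP fun E x => Allow E (x 0) (x 1) (x 2) := by
  have ht : Comp fun E x => traj E (E.reg 0 - rank E (x 1)) :=
    .comp₁ comp_traj ((Comp.reg 0).sub (.comp₁ comp_rank (.var 1)))
  exact (CompP.comp₂ compP_red (.var 1) (.var 2)).and
    ((CompP.comp₂ compP_red (.var 2) (.var 1)).imp (compP_forced_at ht (.var 0) (.var 1) (.var 2)))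

theorem comp_dist : Comp fun E x => dist E (x 0) (x 1) := by
  classical
  refine .sum (F := fun E x d => if x 1 < E.reg 0 ∧ Within (E.reg 0)
    (fun a b => Allow E (x 0) b a) (min d (E.reg 0)) (E.arr 3 (x 0)) (x 1) then 0 else 1) 0
    (by decide) (.ite (CompP.within (R := fun E x a b => Allow E (x 1) b a) ?_ (.var 0)
      (.load 3 (.var 1)) (.var 2)) (.const 0) (.const 1))
  exact .comp₃ compP_allow (.var 3) (.var 0) (.var 1)

theorem comp_next : Comp fun E x => next E (x 0) (x 1) := by
  classical
  exact .loop (F := fun E x v y => if Allow E (x 0) (x 1) v ∧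
    dist E (x 0) v + 1 = dist E (x 0) (x 1) then v else y) 0 (by decide) (.const 0)
    (.ite ((CompP.comp₃ compP_allow (.var 2) (.var 3) (.var 0)).and
      (.eq ((Comp.comp₂ comp_dist (.var 2) (.var 0)).add (.const 1))
        (.comp₂ comp_dist (.var 2) (.var 3)))) (.var 0) (.var 1))

theorem comp_pathEntry : Comp fun E x => pathEntry E (x 0) :=
  .ite (.eq (.modReg 0 (by decide)) (.const 0)) (.load 2 (.divReg 0 (by decide)))
    (.comp₂ comp_next (.divReg 0 (by decide)) (.load 5 ((Comp.var 0).sub (.const 1))))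

theorem comp_lengthEntry : Comp fun E x => lengthEntry E (x 0) :=
  (Comp.comp₂ comp_dist (.var 0) (.load 2 (.var 0))).add (.const 1)

end

end Alg

end CCMAR

/-! ### Bounded reachability. -/

namespace CCMAR

open RAM Finset Relation

section Within

variable {n : ℕ} {R : ℕ → ℕ → Prop}

theorem within_mono {d d' a b : ℕ} (hd : d ≤ d') (h : Within n R d a b) : Within n R d' a b := by
  induction hd with
  | refl => exact h
  | step _ ih => exact .inl ih

theorem reach_of_within {d a b : ℕ} (h : Within n R d a b) : ReflTransGen R a b := by
  induction d generalizing b with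
  | zero => rw [show a = b from h]
  | succ d ih =>
    rcases h with h | ⟨c, -, h, hcb⟩
    · exact ih h
    · exact (ih h).tail hcb

theorem lt_of_reach (hR : ∀ a b, R a b → a < n ∧ b < n) {a b : ℕ} (ha : a < n)
    (h : ReflTransGen R a b) : b < n := by
  cases h with
  | refl => exact ha
  | tail _ h => exact (hR _ _ h).2

/-- A simple path visits at most `n` vertices and so has fewer than `n` steps. -/
theorem exists_within (hR : ∀ a b, R a b → a < n ∧ b < n) {a b : ℕ} (ha : a < n)
    (h : ReflTransGen R a b) : ∃ d < n, Within n R d a b := by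
  obtain ⟨p, hn, hc, hs, ht⟩ := exists_simplePath h
  have hne : p ≠ [] := by rintro rfl; simp at hs
  have h0 : 0 < p.length := List.length_pos_iff.2 hne
  have key : ∀ i (hi : i < p.length), p[i] < n ∧ Within n R i a p[i] := by
    intro i
    induction i with
    | zero =>
      intro hi
      have : p[0] = a := by
        rw [List.head?_eq_getElem?, List.getElem?_eq_getElem hi] at hs
        simpa using hs
      rw [this]
      exact ⟨ha, rfl⟩
    | succ i ih =>
      intro hi
      have hstep := hc.getElem i hi
      exact ⟨(hR _ _ hstep).2, .inr ⟨_, (ih (by omega)).1, (ih (by omega)).2, hstep⟩⟩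
  refine ⟨p.length - 1, ?_, ?_⟩
  · have : p.length ≤ n := by
      rw [← List.toFinset_card_of_nodup hn, ← card_range n]
      refine card_le_card fun x hx => ?_
      obtain ⟨i, hi, rfl⟩ := List.getElem_of_mem (List.mem_toFinset.1 hx)
      exact mem_range.2 (key i hi).1
    omega
  · have := (key (p.length - 1) (by omega)).2
    rwa [← List.getLast_eq_getElem hne, Option.some_injective _
      ((List.getLast?_eq_some_getLast hne).symm.trans ht)] at this

theorem within_iff (hR : ∀ a b, R a b → a < n ∧ b < n) {a b : ℕ} (ha : a < n) :
    (b < n ∧ Within n R n a b) ↔ ReflTransGen R a b := by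
  refine ⟨fun h => reach_of_within h.2, fun h => ⟨lt_of_reach hR ha h, ?_⟩⟩
  obtain ⟨d, hd, h⟩ := exists_within hR ha h
  exact within_mono hd.le h

end Within

/-! ### Independence from the arrays that are filled later. -/

namespace Alg

/-- The registers and the arrays `0`, `2`, `3`, `6` agree. -/
structure Same (E E' : State) : Prop where
  reg : E'.reg = E.reg
  arr₀ : E'.arr 0 = E.arr 0
  arr₂ : E'.arr 2 = E.arr 2
  arr₃ : E'.arr 3 = E.arr 3
  arr₆ : E'.arr 6 = E.arr 6

namespace Same

variable {E E' : State} (h : Same E E')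
include h

theorem red : Red E' = Red E := by funext u v; simp only [Red, h.reg, h.arr₆]
theorem reach : Reach E' = Reach E := by funext u v; simp only [Reach, h.reg, h.red]
theorem rank : rank E' = rank E := by funext v; unfold Alg.rank; rw [h.reg, h.reach]
theorem forced : Forced E' = Forced E := by funext p q u v; simp only [Forced, h.reg, h.red]
theorem divReg (r : ℕ) : divReg r E' = divReg r E := by funext y; simp only [RAM.divReg, h.reg]
theorem modReg (r : ℕ) : modReg r E' = modReg r E := by
  funext y; simp only [RAM.modReg, h.reg, h.divReg]
theorem cell : cell E' = cell E := by funext c i; simp only [Alg.cell, h.reg, h.divReg]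
theorem pos : pos E' = pos E := by funext c i; simp only [Alg.pos, h.modReg, h.cell]
theorem ext : ext E' = ext E := by funext c i; simp only [Alg.ext, h.modReg, h.divReg, h.cell]
theorem wgt : wgt E' = wgt E := by funext u v; simp only [Alg.wgt, h.reg, h.arr₀]
theorem levelCost : levelCost E' = levelCost E := by
  funext r c; unfold Alg.levelCost; rw [h.reg, h.rank, h.forced, h.pos, h.ext, h.wgt]
theorem move : Move E' = Move E := by
  funext t r p q p'; simp only [Move, h.reach, h.rank, h.red]
theorem trans : Trans E' = Trans E := by
  funext r c c'; simp only [Trans, h.reg, h.arr₃, h.move, h.pos, h.ext]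
theorem at₂ : At E' 2 = At E 2 := by funext c; simp only [At, h.reg, h.arr₂, h.pos]
theorem at₃ : At E' 3 = At E 3 := by funext c; simp only [At, h.reg, h.arr₃, h.pos]

variable (h₇ : E'.arr 7 = E.arr 7)
include h₇

theorem tbl : tbl E' = tbl E := by funext l c; simp only [Alg.tbl, h.reg, h₇]
theorem best : best E' = best E := by funext P l; unfold Alg.best; rw [h.reg, h.tbl h₇]
theorem traj : traj E' = traj E := by
  funext j; simp only [Alg.traj, h.reg, h.best h₇, h.trans, h.at₂]
theorem allow : Allow E' = Allow E := by
  funext i a b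
  simp only [Allow, h.red, h.forced, h.pos, h.ext, h.traj h₇, h.reg, h.rank]
theorem dist : dist E' = dist E := by
  funext i v; unfold Alg.dist; rw [h.reg, h.arr₃, h.allow h₇]
theorem next : next E' = next E := by
  funext i u; unfold Alg.next; rw [h.reg, h.allow h₇, h.dist h₇]

end Same

open Classical in
theorem best_spec (E : State) (P : ℕ → Prop) (l : ℕ) :
    (best E P l = 0 ∧ ∀ c < E.reg 2, P c → tbl E l c = 0) ∨
    ∃ c < E.reg 2, best E P l = c + 1 ∧ P c ∧ tbl E l c ≠ 0 ∧
      ∀ c' < E.reg 2, P c' → tbl E l c' ≠ 0 → tbl E l c ≤ tbl E l c' := by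
  unfold best
  generalize E.reg 2 = N
  induction N with
  | zero => exact .inl ⟨rfl, by simp⟩
  | succ N ih =>
    rw [loop_succ]
    generalize loop N 0 _ = b at ih
    rcases ih with ⟨rfl, h⟩ | ⟨c, hc, rfl, h1, h2, h3⟩
    · by_cases hN : P N ∧ tbl E l N ≠ 0
      · refine .inr ⟨N, by omega, by simp [hN], hN.1, hN.2, fun c' hc' h1 h2 => ?_⟩
        rcases Nat.lt_succ_iff_lt_or_eq.1 hc' with h' | rfl
        · exact absurd (h c' h' h1) h2
        · exact le_rfl
      · refine .inl ⟨by simp; tauto, fun c' hc' h1 => ?_⟩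
        rcases Nat.lt_succ_iff_lt_or_eq.1 hc' with h' | rfl
        · exact h c' h' h1
        · by_contra h2; exact hN ⟨h1, h2⟩
    · by_cases hN : P N ∧ tbl E l N ≠ 0 ∧ tbl E l N < tbl E l c
      · refine .inr ⟨N, by omega, by simp [hN], hN.1, hN.2.1, fun c' hc' h4 h5 => ?_⟩
        rcases Nat.lt_succ_iff_lt_or_eq.1 hc' with h' | rfl
        · exact hN.2.2.le.trans (h3 c' h' h4 h5)
        · exact le_rfl
      · refine .inr ⟨c, by omega, by simp; tauto, h1, h2, fun c' hc' h4 h5 => ?_⟩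
        rcases Nat.lt_succ_iff_lt_or_eq.1 hc' with h' | rfl
        · exact h3 c' h' h4 h5
        · by_contra h6; exact hN ⟨h4, h5, by omega⟩

end Alg

end CCMAR

/-! ### Correctness of the reduction, the ranks and the table. -/

namespace CCMAR

open RAM Finset Relation

namespace Alg

variable {E : State}

section Reduction

theorem index_inj {n u v a b : ℕ} (hv : v < n) (hb : b < n) (h : a * n + b = u * n + v) :
    a = u ∧ b = v := by
  have hn : 0 < n := by omega
  have h1 := congrArg (· / n) h
  have h2 := congrArg (· % n) h
  simp only [Nat.mul_add_mod_self_right, Nat.mod_eq_of_lt hv, Nat.mod_eq_of_lt hb] at h2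
  rw [mul_comm a, mul_comm u] at h1
  simp only [Nat.mul_add_div hn, Nat.div_eq_of_lt hv, Nat.div_eq_of_lt hb] at h1
  exact ⟨by omega, h2⟩

theorem index_lt {n k u v : ℕ} (hu : u < k) (hv : v < n) : u * n + v < k * n :=
  calc u * n + v < u * n + n := by omega
    _ = (u + 1) * n := by ring
    _ ≤ k * n := Nat.mul_le_mul_right _ hu

theorem cur_last : Cur E (E.reg 0 * E.reg 0) = Red E := by
  funext u v
  refine propext (and_congr_right fun hu => and_congr_right fun hv => ?_)
  rw [if_pos (index_lt hu hv)]

/-- Array `6` has been filled according to `Keep`. -/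
def ReducedArray (E : State) : Prop :=
  ∀ u < E.reg 0, ∀ v < E.reg 0, E.arr 6 (u * E.reg 0 + v) ≠ 0 ↔ Keep E (u * E.reg 0 + v) u v

theorem cur_succ_iff (h : ReducedArray E) {u v : ℕ} (hu : u < E.reg 0) (hv : v < E.reg 0)
    (a b : ℕ) : Cur E (u * E.reg 0 + v + 1) a b ↔
      Cur E (u * E.reg 0 + v) a b ∧ (a = u ∧ b = v → Keep E (u * E.reg 0 + v) u v) := by
  by_cases hab : a = u ∧ b = v
  · obtain ⟨rfl, rfl⟩ := hab
    have h1 := h a hu b hv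
    have h2 : Keep E (a * E.reg 0 + b) a b → Cur E (a * E.reg 0 + b) a b := And.left
    have h3 : Cur E (a * E.reg 0 + b + 1) a b ↔ E.arr 6 (a * E.reg 0 + b) ≠ 0 := by
      simp [Cur, hu, hv]
    rw [h3, h1]
    tauto
  · refine ⟨fun ⟨ha, hb, h'⟩ => ⟨⟨ha, hb, ?_⟩, fun h => absurd h hab⟩, fun ⟨⟨ha, hb, h'⟩, _⟩ => ⟨ha, hb, ?_⟩⟩
    all_goals
      have hne : a * E.reg 0 + b ≠ u * E.reg 0 + v := fun h => hab (index_inj hv hb h)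
      have : a * E.reg 0 + b < u * E.reg 0 + v + 1 ↔ a * E.reg 0 + b < u * E.reg 0 + v := by omega
      simp only [this] at h' ⊢
      exact h'

theorem cur_supported (m a b : ℕ) (h : Cur E m a b) : a < E.reg 0 ∧ b < E.reg 0 := ⟨h.1, h.2.1⟩

theorem red_supported (a b : ℕ) (h : Red E a b) : a < E.reg 0 ∧ b < E.reg 0 := ⟨h.1, h.2.1⟩

theorem cur_antitone (h : ReducedArray E) {m m' : ℕ} (hm : m ≤ m') (hm' : m' ≤ E.reg 0 * E.reg 0)
    (a b : ℕ) (hab : Cur E m' a b) : Cur E m a b := by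
  induction hm with
  | refl => exact hab
  | @step m' _ ih =>
    have hn : 0 < E.reg 0 := Nat.pos_of_ne_zero fun h0 => by rw [h0] at hm'; omega
    have hu : m' / E.reg 0 < E.reg 0 := (Nat.div_lt_iff_lt_mul hn).2 hm'
    have hv : m' % E.reg 0 < E.reg 0 := Nat.mod_lt _ hn
    have he : m' / E.reg 0 * E.reg 0 + m' % E.reg 0 = m' := Nat.div_add_mod' m' (E.reg 0)
    have := cur_succ_iff h hu hv a b
    rw [he] at this
    exact ih (by omega) (this.1 hab).1

theorem without_supported {S : ℕ → ℕ → Prop} {n u v : ℕ} (hS : ∀ a b, S a b → a < n ∧ b < n)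
    (a b : ℕ) (h : Without S u v a b) : a < n ∧ b < n := hS a b h.1

/-- The relation only shrinks. A walk around `u → v` in the final relation, and the opposite step,
were already there when `u → v` was examined, so the step would have been deleted then. -/
theorem reduced_red (h : ReducedArray E) : Reduced (Red E) := by
  intro u v hne huv hvu hr
  obtain ⟨hu, hv, hk⟩ := huv
  obtain ⟨-, hk⟩ := (h u hu v hv).1 hk
  have hle : ∀ a b, Red E a b → Cur E (u * E.reg 0 + v) a b := fun a b hab =>
    cur_antitone h (index_lt hu hv).le le_rfl a b (cur_last ▸ hab)
  refine hk ⟨hne, hle _ _ hvu, (within_iff (without_supported (cur_supported _)) hu).2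
    (hr.weaken fun a b hab => ⟨hle _ _ hab.1, hab.2⟩)⟩

/-- Every family of walks can be rerouted along the steps in array `6` without new pairs of
opposite steps. -/
theorem exists_reroute_red (h : ReducedArray E) {ι : Type*} (s t : ι → ℕ)
    (U : ι → ℕ → ℕ → Prop) (hUS : ∀ i a b, U i a b → Cur E 0 a b)
    (hU : ∀ i, ReflTransGen (U i) (s i) (t i)) :
    ∃ U' : ι → ℕ → ℕ → Prop, (∀ i a b, U' i a b → Red E a b) ∧
      (∀ i, ReflTransGen (U' i) (s i) (t i)) ∧
      ∀ i j a b, U' i a b → U' j b a → U i a b ∧ U j b a := by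
  have key : ∀ m, m ≤ E.reg 0 * E.reg 0 → ∃ U' : ι → ℕ → ℕ → Prop,
      (∀ i a b, U' i a b → Cur E m a b) ∧ (∀ i, ReflTransGen (U' i) (s i) (t i)) ∧
      ∀ i j a b, U' i a b → U' j b a → U i a b ∧ U j b a := by
    intro m
    induction m with
    | zero => exact fun _ => ⟨U, hUS, hU, fun i j a b h1 h2 => ⟨h1, h2⟩⟩
    | succ m ih =>
      intro hm
      obtain ⟨U₁, h1, h2, h3⟩ := ih (by omega)
      have hn : 0 < E.reg 0 := Nat.pos_of_ne_zero fun h0 => by rw [h0] at hm; omega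
      have hu : m / E.reg 0 < E.reg 0 := (Nat.div_lt_iff_lt_mul hn).2 hm
      have hv : m % E.reg 0 < E.reg 0 := Nat.mod_lt _ hn
      have he : m / E.reg 0 * E.reg 0 + m % E.reg 0 = m := Nat.div_add_mod' m (E.reg 0)
      have hs := cur_succ_iff h hu hv
      rw [he] at hs
      generalize m / E.reg 0 = u at *
      generalize m % E.reg 0 = v at *
      -- This is the case in which the pair is deleted; otherwise the walks stay as they are.
      by_cases hd : u ≠ v ∧ Cur E m v u ∧
          v < E.reg 0 ∧ Within (E.reg 0) (Without (Cur E m) u v) (E.reg 0) u v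
      · obtain ⟨d1, d2, d3⟩ := hd
        rw [within_iff (without_supported (cur_supported _)) hu] at d3
        obtain ⟨U₂, g1, g2, g3⟩ := exists_reroute d1 d2 d3 s t U₁ h1 h2
        refine ⟨U₂, fun i a b hab => (hs a b).2 ⟨(g1 i a b hab).1, fun hab' => ?_⟩, g2,
          fun i j a b k1 k2 => ?_⟩
        · exact absurd hab' (g1 i a b hab).2
        · have := g3 i j a b k1 k2
          exact h3 i j a b this.1 this.2
      · refine ⟨U₁, fun i a b hab => (hs a b).2 ⟨h1 i a b hab, ?_⟩, h2, h3⟩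
        rintro ⟨rfl, rfl⟩
        exact ⟨h1 i a b hab, hd⟩
  obtain ⟨U', h1, h2⟩ := key _ le_rfl
  exact ⟨U', fun i a b hab => cur_last (E := E) ▸ h1 i a b hab, h2⟩

end Reduction

section Rank

theorem reach_iff {u v : ℕ} (hu : u < E.reg 0) : Reach E u v ↔ ReflTransGen (Red E) u v :=
  within_iff red_supported hu

theorem forced_iff {p q u v : ℕ} (hp : p < E.reg 0) :
    Forced E p q u v ↔ ¬ ReflTransGen (Without (Red E) u v) p q :=
  not_congr (within_iff (without_supported red_supported) hp)

open Classical in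
theorem rank_eq {v : ℕ} (hv : v < E.reg 0) :
    rank E v = #{w ∈ range (E.reg 0) | ReflTransGen (Red E) v w} := by
  rw [rank, card_filter]
  refine sum_congr rfl fun w _ => ?_
  simp only [reach_iff hv]

/-- Along a walk the set of reachable vertices shrinks. Equal cardinalities make the two sets equal,
and the first vertex reaches itself. -/
theorem isRank : IsRank (Red E) (rank E) := by
  classical
  constructor
  · intro a b hab
    rw [rank_eq hab.1, rank_eq hab.2.1]
    exact card_le_card (monotone_filter_right _ fun w _ h => .head hab h)
  · intro a b hab hr
    by_cases ha : a < E.reg 0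
    · have hb := lt_of_reach red_supported ha hab
      rw [rank_eq ha, rank_eq hb] at hr
      have := eq_of_subset_of_card_le (monotone_filter_right (range (E.reg 0))
        fun w _ (h : ReflTransGen (Red E) b w) => hab.trans h) hr.le
      have ha' : a ∈ ({w ∈ range (E.reg 0) | ReflTransGen (Red E) b w} : Finset ℕ) := by
        rw [this]; simp [ha, ReflTransGen.refl]
      exact (mem_filter.1 ha').2
    -- A number that is not a vertex has no steps, so only the trivial walk starts there.
    · cases hab using ReflTransGen.head_induction_on with
      | refl => exact .refl
      | head h _ => exact absurd h.1 ha

theorem rank_pos {v : ℕ} (hv : v < E.reg 0) : 0 < rank E v := by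
  classical
  rw [rank_eq hv]
  exact card_pos.2 ⟨v, by simp [hv, ReflTransGen.refl]⟩

theorem rank_le {v : ℕ} (hv : v < E.reg 0) : rank E v ≤ E.reg 0 := by
  classical
  rw [rank_eq hv]
  exact (card_filter_le _ _).trans (card_range _).le

theorem move_iff {t r p q p' : ℕ} (hp : p < E.reg 0) (hq : q < E.reg 0) :
    Move E t r p q p' ↔ Moves (Red E) (rank E) t r p q p' := by
  rw [Move, Moves, reach_iff hp, reach_iff hq]

end Rank

section Table

/-- Array `7` satisfies the recursion of the dynamic program. -/
structure TableArray (E : State) : Prop where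
  zero : ∀ c < E.reg 2, (At E 3 c → tbl E 0 c = 1) ∧ (¬ At E 3 c → tbl E 0 c = 0)
  succ : ∀ l < E.reg 0, ∀ c < E.reg 2,
    (tbl E (l + 1) c = 0 ∧ ∀ c' < E.reg 2, Trans E (l + 1) c c' → tbl E l c' = 0) ∨
    ∃ c' < E.reg 2, Trans E (l + 1) c c' ∧ tbl E l c' ≠ 0 ∧
      (∀ c'' < E.reg 2, Trans E (l + 1) c c'' → tbl E l c'' ≠ 0 → tbl E l c' ≤ tbl E l c'') ∧
      tbl E (l + 1) c = tbl E l c' + levelCost E (l + 1) c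

/-- The total cost of a sequence of configurations. -/
noncomputable def chainCost (E : State) (X : ℕ → ℕ) (l : ℕ) : ℕ :=
  ∑ r ∈ range l, levelCost E (r + 1) (X (r + 1))

/-- Each configuration of an admissible sequence is a candidate in the recursion for the next level.
The summand `1` is the offset that keeps entry `0` free for unreachable targets. -/
theorem TableArray.tbl_le (h : TableArray E) {X : ℕ → ℕ} (hX : ∀ l, X l < E.reg 2)
    (h0 : At E 3 (X 0)) {l : ℕ} (hl : l ≤ E.reg 0)
    (hT : ∀ r < l, Trans E (r + 1) (X (r + 1)) (X r)) :
    tbl E l (X l) ≠ 0 ∧ tbl E l (X l) ≤ 1 + chainCost E X l := by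
  induction l with
  | zero => simp [(h.zero _ (hX 0)).1 h0]
  | succ l ih =>
    obtain ⟨h1, h2⟩ := ih (by omega) fun r hr => hT r (by omega)
    rw [chainCost, sum_range_succ, ← chainCost]
    rcases h.succ l hl _ (hX (l + 1)) with ⟨-, h3⟩ | ⟨c', hc', h3, h4, h5, h6⟩
    · exact absurd (h3 _ (hX l) (hT l (by omega))) h1
    · have := h5 _ (hX l) (hT l (by omega)) h1
      omega

/-- The table stores costs but no choices, so the trajectory searches for a minimiser again on every
level. The costs along it telescope to the top entry. -/
theorem TableArray.traj_spec (h : TableArray E) {c : ℕ} (hc : c < E.reg 2) (hc2 : At E 2 c)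
    (hc0 : tbl E (E.reg 0) c ≠ 0) :
    (∀ l ≤ E.reg 0, traj E (E.reg 0 - l) < E.reg 2) ∧ At E 2 (traj E 0) ∧
      At E 3 (traj E (E.reg 0)) ∧
      (∀ l < E.reg 0, Trans E (l + 1) (traj E (E.reg 0 - (l + 1))) (traj E (E.reg 0 - l))) ∧
      1 + chainCost E (fun l => traj E (E.reg 0 - l)) (E.reg 0) ≤ tbl E (E.reg 0) c := by
  have h0 : traj E 0 < E.reg 2 ∧ At E 2 (traj E 0) ∧ tbl E (E.reg 0) (traj E 0) ≠ 0 ∧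
      tbl E (E.reg 0) (traj E 0) ≤ tbl E (E.reg 0) c := by
    rw [traj, Nat.zero_min, loop_zero]
    rcases best_spec E (At E 2) (E.reg 0) with ⟨-, h1⟩ | ⟨b, hb, h1, h2, h3, h4⟩
    · exact absurd (h1 c hc hc2) hc0
    · rw [h1]
      exact ⟨hb, h2, h3, h4 c hc hc2 hc0⟩
  have hstep : ∀ j < E.reg 0, traj E j < E.reg 2 → tbl E (E.reg 0 - j) (traj E j) ≠ 0 →
      traj E (j + 1) < E.reg 2 ∧ tbl E (E.reg 0 - (j + 1)) (traj E (j + 1)) ≠ 0 ∧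
      Trans E (E.reg 0 - j) (traj E j) (traj E (j + 1)) ∧
      tbl E (E.reg 0 - j) (traj E j) = tbl E (E.reg 0 - (j + 1)) (traj E (j + 1)) +
        levelCost E (E.reg 0 - j) (traj E j) := by
    intro j hj h1 h2
    have ht : traj E (j + 1) = best E (Trans E (E.reg 0 - j) (traj E j)) (E.reg 0 - j - 1) - 1 := by
      rw [traj, min_eq_left (by omega), loop_succ, traj, min_eq_left hj.le]
    obtain ⟨l, hl⟩ : ∃ l, E.reg 0 - j = l + 1 := ⟨E.reg 0 - j - 1, by omega⟩
    have hl' : E.reg 0 - j - 1 = l := by omega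
    have hlt : l < E.reg 0 := by omega
    rw [hl', hl] at ht
    rw [hl] at h2
    rw [show E.reg 0 - (j + 1) = l by omega, hl]
    rcases h.succ l hlt _ h1 with ⟨h3, -⟩ | ⟨c', hc', k1, k2, k3, k4⟩
    · exact absurd h3 h2
    rcases best_spec E (Trans E (l + 1) (traj E j)) l with ⟨-, g1⟩ | ⟨b, hb, g1, g2, g3, g4⟩
    · exact absurd (g1 c' hc' k1) k2
    · rw [ht, g1, Nat.add_sub_cancel]
      refine ⟨hb, g3, g2, ?_⟩
      -- This minimiser may differ from the one behind the table entry, but both have the same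
      -- value.
      rw [k4, le_antisymm (k3 b hb g2 g3) (g4 c' hc' k1 k2)]
  have hall : ∀ j ≤ E.reg 0, traj E j < E.reg 2 ∧ tbl E (E.reg 0 - j) (traj E j) ≠ 0 := by
    intro j
    induction j with
    | zero => exact fun _ => ⟨h0.1, h0.2.2.1⟩
    | succ j ih =>
      intro hj
      have := ih (by omega)
      have := hstep j hj this.1 this.2
      exact ⟨this.1, this.2.1⟩
  have hlev : ∀ l < E.reg 0,
      Trans E (l + 1) (traj E (E.reg 0 - (l + 1))) (traj E (E.reg 0 - l)) ∧
      tbl E (l + 1) (traj E (E.reg 0 - (l + 1))) = tbl E l (traj E (E.reg 0 - l)) +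
        levelCost E (l + 1) (traj E (E.reg 0 - (l + 1))) := by
    intro l hl
    have h1 := hall (E.reg 0 - (l + 1)) (by omega)
    have := (hstep (E.reg 0 - (l + 1)) (by omega) h1.1 h1.2).2.2
    rwa [show E.reg 0 - (E.reg 0 - (l + 1)) = l + 1 by omega,
      show E.reg 0 - (l + 1) + 1 = E.reg 0 - l by omega,
      show E.reg 0 - (E.reg 0 - l) = l by omega] at this
  have hend := hall (E.reg 0) le_rfl
  rw [Nat.sub_self] at hend
  have hat : At E 3 (traj E (E.reg 0)) := by
    by_contra hat
    exact hend.2 ((h.zero _ hend.1).2 hat)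
  refine ⟨fun l hl => (hall _ (by omega)).1, h0.2.1, hat, fun l hl => (hlev l hl).1, ?_⟩
  refine le_trans (le_of_eq ?_) h0.2.2.2
  have hsum : ∀ l ≤ E.reg 0, 1 + chainCost E (fun l => traj E (E.reg 0 - l)) l =
      tbl E l (traj E (E.reg 0 - l)) := by
    intro l
    induction l with
    | zero => simp [chainCost, (h.zero _ hend.1).1 hat]
    | succ l ih =>
      intro hl
      rw [(hlev l hl).2, ← ih (by omega)]
      unfold chainCost
      rw [sum_range_succ]
      ring
  simpa using hsum _ le_rfl

end Table

end Alg

end CCMAR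

/-! ### Configurations as numbers, and both halves of optimality. -/

namespace CCMAR

open RAM Finset Relation

theorem exists_digits (m k : ℕ) (f : ℕ → ℕ) (hf : ∀ i < k, f i < m) :
    ∃ c < m ^ k, ∀ i < k, c / m ^ i % m = f i := by
  induction k generalizing f with
  | zero => exact ⟨0, by simp, by simp⟩
  | succ k ih =>
    obtain ⟨c, hc, h⟩ := ih (fun i => f (i + 1)) fun i hi => hf _ (by omega)
    have h0 := hf 0 (by omega)
    have hm : 0 < m := by omega
    refine ⟨f 0 + m * c, ?_, fun i hi => ?_⟩
    · calc f 0 + m * c < m + m * c := by omega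
        _ = m * (c + 1) := by ring
        _ ≤ m * m ^ k := Nat.mul_le_mul_left _ hc
        _ = m ^ (k + 1) := by ring
    · cases i with
      | zero => simp [Nat.mod_eq_of_lt h0]
      | succ i =>
        rw [pow_succ', ← Nat.div_div_eq_div_mul, Nat.add_mul_div_left _ _ hm,
          Nat.div_eq_of_lt h0, zero_add]
        exact h i (by omega)

namespace Alg

variable {E : State}

/-- The registers hold the sizes that the program uses as bounds of loops. -/
structure Sizes (E : State) : Prop where
  pos : 0 < E.reg 0
  reg₂ : E.reg 2 = (E.reg 0 * E.reg 0) ^ E.reg 1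
  reg₃ : E.reg 3 = E.reg 0 * E.reg 0
  reg₄ : E.reg 4 = (E.reg 0 + 1) * E.reg 2 + E.reg 0 * E.reg 0 + E.reg 1 * E.reg 0

/-- Register `4` bounds every number that is divided: configurations and the indices of pairs, table
entries and path cells. This is what makes `divReg` exact. -/
theorem Sizes.reg₂_le (h : Sizes E) : E.reg 2 ≤ E.reg 4 := by
  rw [h.reg₄, add_mul]; omega

theorem cell_eq (h : Sizes E) {c i : ℕ} (hc : c < E.reg 2) (hi : i ≤ E.reg 1) :
    cell E c i = c / (E.reg 0 * E.reg 0) ^ i := by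
  rw [cell, min_eq_left hi]
  clear hi
  induction i with
  | zero => simp
  | succ i ih =>
    have h3 : 0 < E.reg 3 := by rw [h.reg₃]; exact Nat.mul_pos h.pos h.pos
    rw [loop_succ, ih, divReg_eq h3 ((Nat.div_le_self _ _).trans (hc.le.trans h.reg₂_le)), h.reg₃,
      Nat.div_div_eq_div_mul, pow_succ]

theorem cell_le (h : Sizes E) {c i : ℕ} (hc : c < E.reg 2) (hi : i ≤ E.reg 1) :
    cell E c i ≤ E.reg 4 :=
  (cell_eq h hc hi).trans_le ((Nat.div_le_self _ _).trans (hc.le.trans h.reg₂_le))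

theorem pos_eq (h : Sizes E) {c i : ℕ} (hc : c < E.reg 2) (hi : i ≤ E.reg 1) :
    pos E c i = c / (E.reg 0 * E.reg 0) ^ i % E.reg 0 := by
  rw [pos, modReg_eq h.pos (cell_le h hc hi), cell_eq h hc hi]

theorem ext_eq (h : Sizes E) {c i : ℕ} (hc : c < E.reg 2) (hi : i ≤ E.reg 1) :
    ext E c i = c / (E.reg 0 * E.reg 0) ^ i / E.reg 0 % E.reg 0 := by
  have hle := cell_le h hc hi
  rw [ext, divReg_eq h.pos hle, modReg_eq h.pos ((Nat.div_le_self _ _).trans hle), cell_eq h hc hi]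

theorem pos_lt (h : Sizes E) {c i : ℕ} (hc : c < E.reg 2) (hi : i < E.reg 1) :
    pos E c i < E.reg 0 := by
  rw [pos_eq h hc hi.le]; exact Nat.mod_lt _ h.pos

theorem ext_lt (h : Sizes E) {c i : ℕ} (hc : c < E.reg 2) (hi : i < E.reg 1) :
    ext E c i < E.reg 0 := by
  rw [ext_eq h hc hi.le]; exact Nat.mod_lt _ h.pos

theorem exists_config (h : Sizes E) (P Q : ℕ → ℕ) (hP : ∀ i < E.reg 1, P i < E.reg 0)
    (hQ : ∀ i < E.reg 1, Q i < E.reg 0) :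
    ∃ c < E.reg 2, ∀ i < E.reg 1, pos E c i = P i ∧ ext E c i = Q i := by
  obtain ⟨c, hc, hd⟩ := exists_digits (E.reg 0 * E.reg 0) (E.reg 1) (fun i => Q i * E.reg 0 + P i)
    fun i hi => index_lt (hQ i hi) (hP i hi)
  rw [← h.reg₂] at hc
  refine ⟨c, hc, fun i hi => ?_⟩
  rw [pos_eq h hc hi.le, ext_eq h hc hi.le, ← Nat.mod_mul_right_mod _ (E.reg 0) (E.reg 0),
    ← Nat.mod_mul_right_div_self (c / (E.reg 0 * E.reg 0) ^ i) (E.reg 0) (E.reg 0), hd i hi]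
  constructor
  · rw [Nat.mul_add_mod_self_right, Nat.mod_eq_of_lt (hP i hi)]
  · rw [mul_comm, Nat.mul_add_div h.pos, Nat.div_eq_of_lt (hP i hi), add_zero]

open Classical in
/-- Twice the cost of a family of walks that take the steps in `U`. -/
noncomputable def crossing (E : State) (U : ℕ → ℕ → ℕ → Prop) : ℕ :=
  ∑ u ∈ range (E.reg 0), ∑ v ∈ range (E.reg 0), ∑ i ∈ range (E.reg 1), ∑ j ∈ range (E.reg 1),
    if U i u v ∧ U j v u then wgt E u v else 0

theorem crossing_le {U U' : ℕ → ℕ → ℕ → Prop}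
    (h : ∀ i < E.reg 1, ∀ j < E.reg 1, ∀ u < E.reg 0, ∀ v < E.reg 0, U i u v → U j v u →
      U' i u v ∧ U' j v u) : crossing E U ≤ crossing E U' := by
  classical
  refine sum_le_sum fun u hu => sum_le_sum fun v hv => sum_le_sum fun i hi =>
    sum_le_sum fun j hj => ?_
  have := h i (mem_range.1 hi) j (mem_range.1 hj) u (mem_range.1 hu) v (mem_range.1 hv)
  split_ifs with h1 h2
  · exact le_rfl
  · exact absurd (this h1.1 h1.2) h2
  · exact Nat.zero_le _
  · exact le_rfl

/-- The steps which agent `i` cannot avoid in the sequence `X` of configurations. -/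
def ForcedBy (E : State) (X : ℕ → ℕ) (i u v : ℕ) : Prop :=
  Forced E (pos E (X (rank E u)) i) (ext E (X (rank E u)) i) u v

-- A vertex has exactly one rank, between `1` and `n`, so it contributes on exactly one level.
open Classical in
theorem chainCost_eq (X : ℕ → ℕ) : chainCost E X (E.reg 0) =
    ∑ u ∈ range (E.reg 0), ∑ v ∈ range (E.reg 0), ∑ i ∈ range (E.reg 1), ∑ j ∈ range (E.reg 1),
      if ForcedBy E X i u v ∧
        Forced E (pos E (X (rank E u)) j) (ext E (X (rank E u)) j) v u then wgt E u v else 0 := by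
  simp only [chainCost, levelCost]
  rw [sum_comm]
  refine sum_congr rfl fun u hu => ?_
  rw [sum_comm]
  refine sum_congr rfl fun v _ => ?_
  rw [sum_comm]
  refine sum_congr rfl fun i _ => ?_
  rw [sum_comm]
  refine sum_congr rfl fun j _ => ?_
  have hu := mem_range.1 hu
  have h1 := rank_pos hu
  have h2 := rank_le hu
  rw [sum_eq_single (rank E u - 1)]
  · rw [Nat.sub_add_cancel h1]
    refine if_congr ?_ rfl rfl
    simp [ForcedBy]
  · intro r _ hr
    exact if_neg fun h => hr (by omega)
  · intro h
    exact absurd (mem_range.2 (by omega)) h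

/-- Scheduling each walk inside `U i` yields configurations whose entrance and exit are joined by
steps of `U i`. A forced step must therefore belong to `U i`, so the sequence costs at most as much
as the crossings of `U`. -/
theorem TableArray.exists_le_crossing (h : TableArray E) (hE : Sizes E) (U : ℕ → ℕ → ℕ → Prop)
    (hUR : ∀ i < E.reg 1, ∀ a b, U i a b → Red E a b) (hs : ∀ i < E.reg 1, E.arr 2 i < E.reg 0)
    (hU : ∀ i < E.reg 1, ReflTransGen (U i) (E.arr 2 i) (E.arr 3 i)) :
    ∃ c < E.reg 2, At E 2 c ∧ tbl E (E.reg 0) c ≠ 0 ∧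
      tbl E (E.reg 0) c ≤ 1 + crossing E U := by
  have hex : ∀ i, ∃ P Q : ℕ → ℕ, i < E.reg 1 → P (E.reg 0) = E.arr 2 i ∧ P 0 = E.arr 3 i ∧
      (∀ l < E.reg 0, Moves (Red E) (rank E) (E.arr 3 i) (l + 1) (P (l + 1)) (Q (l + 1)) (P l)) ∧
      ∀ l, ReflTransGen (U i) (E.arr 2 i) (P l) ∧ ReflTransGen (U i) (P l) (Q l) := by
    intro i
    by_cases hi : i < E.reg 1
    · have ht := lt_of_reach red_supported (hs i hi) ((hU i hi).weaken (hUR i hi))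
      obtain ⟨P, Q, h'⟩ := isRank.exists_schedule (hUR i hi) (t := E.arr 3 i) (E.reg 0)
        (fun p hp => rank_pos (by
          cases hp using ReflTransGen.head_induction_on with
          | refl => exact ht
          | head h _ => exact (hUR i hi _ _ h).1))
        (E.arr 2 i) (hU i hi) (.inl (rank_le (hs i hi)))
      exact ⟨P, Q, fun _ => h'⟩
    · exact ⟨id, id, fun h => absurd h hi⟩
  choose P Q hPQ using hex
  have hPlt : ∀ l, ∀ i < E.reg 1, P i l < E.reg 0 := fun l i hi =>
    lt_of_reach red_supported (hs i hi) (((hPQ i hi).2.2.2 l).1.weaken (hUR i hi))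
  have hQlt : ∀ l, ∀ i < E.reg 1, Q i l < E.reg 0 := fun l i hi =>
    lt_of_reach red_supported (hPlt l i hi) (((hPQ i hi).2.2.2 l).2.weaken (hUR i hi))
  choose X hX hXPQ using fun l => exists_config hE (P · l) (Q · l) (hPlt l) (hQlt l)
  have hcost : chainCost E X (E.reg 0) ≤ crossing E U := by
    classical
    rw [chainCost_eq]
    have hf : ∀ r, ∀ i < E.reg 1, ∀ u v, Forced E (pos E (X r) i) (ext E (X r) i) u v → U i u v := by
      intro r i hi u v hf
      rw [(hXPQ r i hi).1, (hXPQ r i hi).2, forced_iff (hPlt r i hi)] at hf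
      by_contra hn
      exact hf (((hPQ i hi).2.2.2 r).2.weaken fun a b hab => ⟨hUR i hi a b hab, by
        rintro ⟨rfl, rfl⟩; exact hn hab⟩)
    refine sum_le_sum fun u hu => sum_le_sum fun v hv => sum_le_sum fun i hi =>
      sum_le_sum fun j hj => ?_
    have h1 := hf (rank E u) i (mem_range.1 hi) u v
    have h2 := hf (rank E u) j (mem_range.1 hj) v u
    split_ifs with h3 h4
    · exact le_rfl
    · exact absurd ⟨h1 h3.1, h2 h3.2⟩ h4
    · exact Nat.zero_le _
    · exact le_rfl
  have := h.tbl_le hX (fun i hi => (hXPQ 0 i hi).1.trans (hPQ i hi).2.1) le_rfl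
    fun r hr i hi => by
      rw [(hXPQ _ i hi).1, (hXPQ _ i hi).2, (hXPQ _ i hi).1,
        move_iff (hPlt _ i hi) (hQlt _ i hi)]
      exact (hPQ i hi).2.2.1 r hr
  exact ⟨X (E.reg 0), hX _, fun i hi => (hXPQ _ i hi).1.trans (hPQ i hi).1, this.1,
    this.2.trans (by omega)⟩

/-- If one agent may take `u → v` and another `v → u`, both steps have opposites, so each is allowed
only because it is forced. Both vertices then have the same rank, and the pair is already paid for
on that level. -/
theorem TableArray.allow_spec (h : TableArray E) (hE : Sizes E) (hred : Reduced (Red E)) {c : ℕ}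
    (hc : c < E.reg 2) (hc2 : At E 2 c) (hc0 : tbl E (E.reg 0) c ≠ 0) :
    (∀ i < E.reg 1, ReflTransGen (Allow E i) (E.arr 2 i) (E.arr 3 i)) ∧
      1 + crossing E (Allow E) ≤ tbl E (E.reg 0) c := by
  obtain ⟨h1, h2, h3, h4, h5⟩ := h.traj_spec hc hc2 hc0
  set X : ℕ → ℕ := fun l => traj E (E.reg 0 - l) with hX
  have hXlt : ∀ l, X l < E.reg 2 := fun l => by
    rcases le_total l (E.reg 0) with hl | hl
    · exact h1 l hl
    -- Above level `n` the truncated subtraction gives the top configuration again.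
    · have := h1 (E.reg 0) le_rfl
      rw [Nat.sub_self] at this
      simpa [hX, Nat.sub_eq_zero_of_le hl] using this
  refine ⟨fun i hi => ?_, le_trans (Nat.add_le_add_left ?_ 1) h5⟩
  · have := hred.reach_allowed isRank (t := E.arr 3 i) (P := fun l => pos E (X l) i)
      (Q := fun l => ext E (X l) i) (E.reg 0) fun l hl =>
        (move_iff (pos_lt hE (hXlt _) hi) (ext_lt hE (hXlt _) hi)).1 (h4 l hl i hi)
    have e1 : pos E (X (E.reg 0)) i = E.arr 2 i := by simpa [hX] using h2 i hi
    have e2 : pos E (X 0) i = E.arr 3 i := by simpa [hX] using h3 i hi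
    simp only [e1, e2] at this
    refine this.weaken fun a b hab => ⟨hab.1, fun hba => ?_⟩
    exact (forced_iff (pos_lt hE (hXlt _) hi)).2 (hab.2 hba)
  · classical
    rw [chainCost_eq]
    refine sum_le_sum fun u hu => sum_le_sum fun v hv => sum_le_sum fun i hi =>
      sum_le_sum fun j hj => ?_
    split_ifs with g1 g2
    · exact le_rfl
    · refine absurd ⟨g1.1.2 g1.2.1, ?_⟩ g2
      have hr : rank E v = rank E u :=
        le_antisymm (isRank.le _ _ g1.1.1) (isRank.le _ _ g1.2.1)
      have := g1.2.2 g1.1.1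
      rwa [hr] at this
    · exact Nat.zero_le _
    · exact le_rfl

/-! ### Shortest paths along allowed steps -/

theorem allow_supported (i a b : ℕ) (h : Allow E i a b) : a < E.reg 0 ∧ b < E.reg 0 :=
  red_supported a b h.1

/-- By monotonicity, the insufficient numbers of steps form an initial segment, so counting them
gives the distance. The search runs backwards from the target. -/
theorem dist_le_iff {i v d : ℕ} (hv : v < E.reg 0) (hd : d < E.reg 0) :
    dist E i v ≤ d ↔ Within (E.reg 0) (fun a b => Allow E i b a) d (E.arr 3 i) v := by
  classical
  have hdist : dist E i v = #{e ∈ range (E.reg 0) |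
      ¬ Within (E.reg 0) (fun a b => Allow E i b a) e (E.arr 3 i) v} := by
    rw [dist, card_filter]
    refine sum_congr rfl fun e he => ?_
    rw [min_eq_left (mem_range.1 he).le]
    by_cases h : Within (E.reg 0) (fun a b => Allow E i b a) e (E.arr 3 i) v <;> simp [h, hv]
  rw [hdist]
  constructor
  · intro h
    by_contra hn
    have : range (d + 1) ⊆ {e ∈ range (E.reg 0) |
        ¬ Within (E.reg 0) (fun a b => Allow E i b a) e (E.arr 3 i) v} := fun e he => by
      have he := mem_range.1 he
      exact mem_filter.2 ⟨mem_range.2 (by omega), fun h' => hn (within_mono (by omega) h')⟩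
    have := card_le_card this
    rw [card_range] at this
    omega
  · intro h
    refine (card_le_card (t := range d) fun e he => mem_range.2 ?_).trans (card_range d).le
    by_contra hn
    exact (mem_filter.1 he).2 (within_mono (by omega) h)

open Classical in
theorem next_spec {i u : ℕ} (h : ∃ v < E.reg 0, Allow E i u v ∧ dist E i v + 1 = dist E i u) :
    Allow E i u (next E i u) ∧ dist E i (next E i u) + 1 = dist E i u := by
  unfold next
  generalize E.reg 0 = n at h
  induction n with
  | zero => simp at h
  | succ n ih =>
    rw [loop_succ]
    split_ifs with hn
    · exact hn
    · refine ih ?_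
      obtain ⟨v, hv, h⟩ := h
      rcases Nat.lt_succ_iff_lt_or_eq.1 hv with h' | rfl
      · exact ⟨v, h', h⟩
      · exact absurd h hn

theorem exists_next {i v m : ℕ} (hv : v < E.reg 0) (hm : m + 1 < E.reg 0)
    (h : dist E i v = m + 1) : ∃ w < E.reg 0, Allow E i v w ∧ dist E i w + 1 = dist E i v := by
  have h1 := (dist_le_iff hv hm).1 h.le
  have h2 : ¬ Within (E.reg 0) (fun a b => Allow E i b a) m (E.arr 3 i) v := fun h' => by
    have := (dist_le_iff hv (by omega)).2 h'; omega
  rcases h1 with h1 | ⟨c, hc, h1, h3⟩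
  · exact absurd h1 h2
  · refine ⟨c, hc, h3, ?_⟩
    have h4 := (dist_le_iff hc (show m < E.reg 0 by omega)).2 h1
    -- A smaller distance of `c` would already put `v` within `m` steps of the target.
    by_contra hne
    obtain ⟨m, rfl⟩ : ∃ m', m = m' + 1 := ⟨m - 1, by omega⟩
    have h5 := (dist_le_iff (i := i) hc (show m < E.reg 0 by omega)).1 (by omega)
    exact h2 (.inr ⟨c, hc, h5, h3⟩)

/-- Array `5` has been filled according to `next`. -/
def PathArray (E : State) : Prop := ∀ i < E.reg 1, ∀ j < E.reg 0,
  E.arr 5 (i * E.reg 0 + j) =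
    if j = 0 then E.arr 2 i else next E i (E.arr 5 (i * E.reg 0 + j - 1))

/-- The distance drops by exactly one from cell to cell, so it reaches `0`, that is the target,
after `dist E i (E.arr 2 i)` steps. -/
theorem PathArray.spec (h : PathArray E) {i : ℕ} (hi : i < E.reg 1) (hs : E.arr 2 i < E.reg 0)
    (hr : ReflTransGen (Allow E i) (E.arr 2 i) (E.arr 3 i)) :
    dist E i (E.arr 2 i) < E.reg 0 ∧
    (∀ j ≤ dist E i (E.arr 2 i), E.arr 5 (i * E.reg 0 + j) < E.reg 0 ∧
      dist E i (E.arr 5 (i * E.reg 0 + j)) + j = dist E i (E.arr 2 i)) ∧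
    (∀ j < dist E i (E.arr 2 i),
      Allow E i (E.arr 5 (i * E.reg 0 + j)) (E.arr 5 (i * E.reg 0 + (j + 1)))) ∧
    E.arr 5 (i * E.reg 0) = E.arr 2 i ∧
    E.arr 5 (i * E.reg 0 + dist E i (E.arr 2 i)) = E.arr 3 i := by
  have ht := lt_of_reach (allow_supported i) hs hr
  have hd : dist E i (E.arr 2 i) < E.reg 0 := by
    obtain ⟨d, hd, h'⟩ := exists_within (R := fun a b => Allow E i b a)
      (fun a b hab => (allow_supported i b a hab).symm) ht (reflTransGen_swap.2 hr)
    exact ((dist_le_iff hs hd).2 h').trans_lt hd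
  have h0 : E.arr 5 (i * E.reg 0) = E.arr 2 i := by simpa using h i hi 0 (by omega)
  have hstep : ∀ j < dist E i (E.arr 2 i), E.arr 5 (i * E.reg 0 + j) < E.reg 0 →
      dist E i (E.arr 5 (i * E.reg 0 + j)) + j = dist E i (E.arr 2 i) →
      Allow E i (E.arr 5 (i * E.reg 0 + j)) (E.arr 5 (i * E.reg 0 + (j + 1))) ∧
      dist E i (E.arr 5 (i * E.reg 0 + (j + 1))) + 1 = dist E i (E.arr 5 (i * E.reg 0 + j)) := by
    intro j hj h1 h2
    have := h i hi (j + 1) (by omega)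
    rw [if_neg (by omega), show i * E.reg 0 + (j + 1) - 1 = i * E.reg 0 + j by omega] at this
    rw [this]
    exact next_spec (exists_next (m := dist E i (E.arr 5 (i * E.reg 0 + j)) - 1) h1 (by omega)
      (by omega))
  have hall : ∀ j ≤ dist E i (E.arr 2 i), E.arr 5 (i * E.reg 0 + j) < E.reg 0 ∧
      dist E i (E.arr 5 (i * E.reg 0 + j)) + j = dist E i (E.arr 2 i) := by
    intro j
    induction j with
    | zero => intro _; simp [h0, hs]
    | succ j ih =>
      intro hj
      obtain ⟨h1, h2⟩ := ih (by omega)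
      obtain ⟨h3, h4⟩ := hstep j hj h1 h2
      exact ⟨(allow_supported i _ _ h3).2, by omega⟩
  refine ⟨hd, hall, fun j hj => (hstep j hj (hall j hj.le).1 (hall j hj.le).2).1, h0, ?_⟩
  obtain ⟨h1, h2⟩ := hall _ le_rfl
  exact ((dist_le_iff h1 (by omega : 0 < E.reg 0)).1 (by omega)).symm

end Alg

end CCMAR

/-! ### Filling the registers and the arrays. -/

namespace CCMAR

open RAM Finset Relation

namespace Alg

theorem exists_leads_sizes : ∃ p T, PolyBound T ∧ ∀ (E : State) (B : ℕ), 1 ≤ B → 0 < E.reg 0 →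
    (∀ g < 8, E.reg g ≤ B) → (E.reg 0 + 1) * (E.reg 0 * E.reg 0) ^ E.reg 1 + E.reg 0 * E.reg 0 +
      E.reg 1 * E.reg 0 ≤ B →
    ∃ E', Leads p (T B) E E' ∧ (∀ g < 8, E'.reg g ≤ B) ∧ E'.arr = E.arr ∧ E'.reg 0 = E.reg 0 ∧
      E'.reg 1 = E.reg 1 ∧ Sizes E' ∧ E'.reg 5 = E'.reg 1 * E'.reg 0 ∧
      E'.reg 6 = (E'.reg 0 + 1) * E'.reg 2 := by
  obtain ⟨p₂, T₂, hT₂, h₂⟩ := Comp.exists_leads_setReg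
    (f := fun E => loop (E.reg 1) 1 fun _ y => y * E.reg 0 * E.reg 0)
    (.loop (F := fun E _ _ y => y * E.reg 0 * E.reg 0) 1 (by decide) (.const 1)
      (((Comp.var 1).mulReg 0 (by decide)).mulReg 0 (by decide))) 2 (by decide)
  obtain ⟨p₃, T₃, hT₃, h₃⟩ := Comp.exists_leads_setReg (f := fun E => E.reg 0 * E.reg 0)
    ((Comp.reg 0).mulReg 0 (by decide)) 3 (by decide)
  obtain ⟨p₅, T₅, hT₅, h₅⟩ := Comp.exists_leads_setReg (f := fun E => E.reg 1 * E.reg 0)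
    ((Comp.reg 1).mulReg 0 (by decide)) 5 (by decide)
  obtain ⟨p₆, T₆, hT₆, h₆⟩ := Comp.exists_leads_setReg (f := fun E => (E.reg 0 + 1) * E.reg 2)
    (((Comp.reg 0).add (.const 1)).mulReg 2 (by decide)) 6 (by decide)
  obtain ⟨p₄, T₄, hT₄, h₄⟩ := Comp.exists_leads_setReg (f := fun E => E.reg 6 + E.reg 3 + E.reg 5)
    (((Comp.reg 6).add (.reg 3)).add (.reg 5)) 4 (by decide)
  -- Register `4` is set last, as the sum of registers `6`, `3` and `5`.
  refine ⟨.seq p₂ (.seq p₃ (.seq p₅ (.seq p₆ p₄))), _, hT₂.add (hT₃.add (hT₅.add (hT₆.add hT₄))), fun E B hB hn hE hle => ?_⟩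
  have hset : ∀ {E : State} {r v : ℕ}, (∀ g < 8, E.reg g ≤ B) → v ≤ B →
      ∀ g < 8, (E.setReg r v).reg g ≤ B := fun {E r v} h hv g hg => by
    rcases eq_or_ne g r with rfl | hne
    · simpa using hv
    · rw [State.setReg_reg_of_ne _ _ hne]; exact h g hg
  have hpow : ∀ m y : ℕ, loop m 1 (fun _ z => z * y * y) = (y * y) ^ m := fun m y => by
    induction m with
    | zero => rfl
    | succ m ih => rw [loop_succ, ih, pow_succ, mul_assoc]
  set N := (E.reg 0 * E.reg 0) ^ E.reg 1 with hN
  have hle' : N ≤ (E.reg 0 + 1) * N := Nat.le_mul_of_pos_left _ (by omega)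
  have e₂ := h₂ E B hB hE
  rw [hpow, ← hN] at e₂
  have b₂ := hset (r := 2) hE (show N ≤ B by omega)
  have e₃ := h₃ _ B hB b₂
  have b₃ := hset (r := 3) b₂ (show E.reg 0 * E.reg 0 ≤ B by omega)
  have e₅ := h₅ _ B hB b₃
  have b₅ := hset (r := 5) b₃ (show E.reg 1 * E.reg 0 ≤ B by omega)
  have e₆ := h₆ _ B hB b₅
  have b₆ := hset (r := 6) b₅ (show (E.reg 0 + 1) * N ≤ B by omega)
  have e₄ := h₄ _ B hB b₆
  have b₄ := hset (r := 4) b₆ hle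
  refine ⟨_, e₂.seq (e₃.seq (e₅.seq (e₆.seq e₄))), b₄, rfl, rfl, rfl, ⟨hn, rfl, rfl, rfl⟩, rfl, rfl⟩

theorem Same.tabulate {E : State} {a : ℕ} (f : State → ℕ → ℕ) (m : ℕ) (h0 : 0 ≠ a := by decide)
    (h2 : 2 ≠ a := by decide) (h3 : 3 ≠ a := by decide) (h6 : 6 ≠ a := by decide) :
    Same E (tabulate a f E m) :=
  ⟨tabulate_reg .., tabulate_arr_of_ne _ _ _ h0, tabulate_arr_of_ne _ _ _ h2,
    tabulate_arr_of_ne _ _ _ h3, tabulate_arr_of_ne _ _ _ h6⟩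

theorem tabulate_arr_self_of_le {a i m m' : ℕ} (f : State → ℕ → ℕ) (E : State) (h : i < m)
    (h' : m ≤ m') : (tabulate a f E m).arr a i = (tabulate a f E m').arr a i := by
  rw [tabulate_arr_self f E h, tabulate_arr_self f E (h.trans_le h')]

theorem cur_congr {E E' : State} (h : Same E E') (h1 : E'.arr 1 = E.arr 1) : Cur E' = Cur E := by
  funext m u v
  simp only [Cur, Step₀, h.wgt, h.reg, h1, h.arr₆]

theorem ReducedArray.congr {E E' : State} (hE : ReducedArray E) (h : Same E E')
    (h1 : E'.arr 1 = E.arr 1) : ReducedArray E' := by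
  unfold ReducedArray Keep at *
  rw [h.reg, h.arr₆, cur_congr h h1]
  exact hE

/-- `Cur E m` reads array `6` only below the index `m`, and those cells are final when cell `m` is
computed. -/
theorem reducedArray_tabulate {E : State} (hE : Sizes E) :
    ReducedArray (tabulate 6 keepEntry E (E.reg 3)) := by
  classical
  intro u hu v hv
  rw [tabulate_reg] at hu hv ⊢
  set m := u * E.reg 0 + v with hm
  have hm3 : m < E.reg 3 := by rw [hE.reg₃]; exact index_lt hu hv
  have hm4 : m ≤ E.reg 4 := by rw [hE.reg₄, ← hE.reg₃]; omega
  set E₁ := tabulate 6 keepEntry E m with hE₁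
  have hreg : E₁.reg = E.reg := tabulate_reg ..
  have hdiv : divReg 0 E₁ m = u := by
    rw [divReg_eq (by rw [hreg]; exact hE.pos) (by rwa [hreg]), hreg, hm, mul_comm,
      Nat.mul_add_div hE.pos, Nat.div_eq_of_lt hv, add_zero]
  have hmod : modReg 0 E₁ m = v := by
    rw [modReg_eq (by rw [hreg]; exact hE.pos) (by rwa [hreg]), hreg, hm,
      Nat.mul_add_mod_self_right, Nat.mod_eq_of_lt hv]
  have hcur : Cur E₁ m = Cur (tabulate 6 keepEntry E (E.reg 3)) m := by
    funext a b
    simp only [Cur, Step₀, wgt, hE₁, tabulate_reg,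
      tabulate_arr_of_ne (a := 6) (a' := 0) _ _ _ (by decide),
      tabulate_arr_of_ne (a := 6) (a' := 1) _ _ _ (by decide)]
    refine propext (and_congr_right fun _ => and_congr_right fun _ => ?_)
    split_ifs with h
    · rw [tabulate_arr_self_of_le _ _ h hm3.le]
    · exact Iff.rfl
  have hkeep : Keep E₁ m u v ↔ Keep (tabulate 6 keepEntry E (E.reg 3)) m u v := by
    rw [Keep, Keep, hcur, hreg, tabulate_reg]
  rw [tabulate_arr_self _ _ hm3, ← hE₁, keepEntry, hdiv, hmod, ← hkeep]
  split_ifs with h <;> simp [h]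

theorem TableArray.congr {E E' : State} (hE : TableArray E) (h : Same E E')
    (h7 : E'.arr 7 = E.arr 7) : TableArray E' := by
  obtain ⟨h1, h2⟩ := hE
  constructor
  · rw [h.reg, h.at₃, h.tbl h7]; exact h1
  · rw [h.reg, h.trans, h.tbl h7, h.levelCost]; exact h2

/-- The index has the level as its leading part, so all entries on lower levels are final when an
entry is computed. -/
theorem tableArray_tabulate {E : State} (hE : Sizes E) (h6 : E.reg 6 = (E.reg 0 + 1) * E.reg 2) :
    TableArray (tabulate 7 tblEntry E (E.reg 6)) := by
  classical
  set E' := tabulate 7 tblEntry E (E.reg 6) with hE'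
  have hreg : E'.reg = E.reg := tabulate_reg ..
  have hN : 0 < E.reg 2 := by rw [hE.reg₂]; exact pow_pos (Nat.mul_pos hE.pos hE.pos) _
  have hS : Same E E' := .tabulate _ _
  have key : ∀ l ≤ E.reg 0, ∀ c < E.reg 2, ∃ E₁, Same E' E₁ ∧ tbl E' l c = entry E₁ l c ∧
      ∀ l' < l, ∀ c' < E.reg 2, tbl E₁ l' c' = tbl E' l' c' := by
    intro l hl c hc
    set y := l * E.reg 2 + c with hy
    have hy6 : y < E.reg 6 := by rw [h6]; exact index_lt (by omega) hc
    have hy4 : y ≤ E.reg 4 := by rw [hE.reg₄, ← h6]; omega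
    have hS₁ : Same E (tabulate 7 tblEntry E y) := .tabulate _ _
    refine ⟨tabulate 7 tblEntry E y, ⟨hS₁.reg.trans hS.reg.symm, hS₁.arr₀.trans hS.arr₀.symm,
      hS₁.arr₂.trans hS.arr₂.symm, hS₁.arr₃.trans hS.arr₃.symm, hS₁.arr₆.trans hS.arr₆.symm⟩, ?_, ?_⟩
    · rw [tbl, hreg, ← hy, hE', tabulate_arr_self _ _ hy6, tblEntry, hS₁.divReg, hS₁.modReg,
        divReg_eq hN hy4, modReg_eq hN hy4, hy, mul_comm, Nat.mul_add_div hN,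
        Nat.div_eq_of_lt hc, add_zero, Nat.mul_add_mod_self_left, Nat.mod_eq_of_lt hc]
    · intro l' hl' c' hc'
      rw [tbl, tbl, hreg, tabulate_reg, hE']
      refine tabulate_arr_self_of_le _ _ ?_ hy6.le
      exact (index_lt hl' hc').trans_le (Nat.le_add_right _ _)
  constructor
  · intro c hc
    rw [hreg] at hc
    obtain ⟨E₁, h1, h2, -⟩ := key 0 (Nat.zero_le _) c hc
    rw [h2, entry, if_pos rfl, h1.at₃]
    exact ⟨fun h => if_pos h, fun h => if_neg h⟩
  · intro l hl c hc
    rw [hreg] at hl hc ⊢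
    obtain ⟨E₁, h1, h2, h3⟩ := key (l + 1) hl c hc
    rw [entry, if_neg (by omega), h1.trans, h1.levelCost, Nat.add_sub_cancel] at h2
    have h3 := h3 l (by omega)
    have hb := best_spec E₁ (Trans E' (l + 1) c) l
    rw [h1.reg, hreg] at hb
    rcases hb with ⟨h4, h5⟩ | ⟨b, hb, h4, h5, h6, h7⟩
    · exact .inl ⟨by rw [h2, if_pos h4], fun c' hc' ht => by rw [← h3 c' hc']; exact h5 c' hc' ht⟩
    · rw [h3 b hb] at h6 h7
      rw [h4, if_neg (by omega), Nat.add_sub_cancel, h3 b hb] at h2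
      exact .inr ⟨b, hb, h5, h6, fun c' hc' ht h0 => by
        rw [← h3 c' hc'] at h0 ⊢
        exact h7 c' hc' ht h0, h2⟩

theorem PathArray.congr {E E' : State} (hE : PathArray E) (h : Same E E')
    (h5 : E'.arr 5 = E.arr 5) (h7 : E'.arr 7 = E.arr 7) : PathArray E' := by
  unfold PathArray
  rw [h.reg, h5, h.arr₂, h.next h7]
  exact hE

theorem pathArray_tabulate {E : State} (hE : Sizes E) (h5 : E.reg 5 = E.reg 1 * E.reg 0) :
    PathArray (tabulate 5 pathEntry E (E.reg 5)) := by
  intro i hi j hj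
  rw [tabulate_reg] at hi hj ⊢
  set x := i * E.reg 0 + j with hx
  have hx5 : x < E.reg 5 := by rw [h5]; exact index_lt hi hj
  have hx4 : x ≤ E.reg 4 := by rw [hE.reg₄, ← h5]; omega
  have hS₁ : Same E (tabulate 5 pathEntry E x) := .tabulate _ _
  have hS : Same E (tabulate 5 pathEntry E (E.reg 5)) := .tabulate _ _
  have hdiv : x / E.reg 0 = i := by
    rw [hx, mul_comm, Nat.mul_add_div hE.pos, Nat.div_eq_of_lt hj, add_zero]
  have hmod : x % E.reg 0 = j := by rw [hx, Nat.mul_add_mod_self_right, Nat.mod_eq_of_lt hj]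
  rw [tabulate_arr_self _ _ hx5, pathEntry, hS₁.divReg, hS₁.modReg, divReg_eq hE.pos hx4,
    modReg_eq hE.pos hx4, hdiv, hmod, hS₁.arr₂, hS.arr₂,
    hS₁.next (tabulate_arr_of_ne _ _ _ (by decide)), hS.next (tabulate_arr_of_ne _ _ _ (by decide))]
  by_cases h0 : j = 0
  · rw [if_pos h0, if_pos h0]
  · rw [if_neg h0, if_neg h0, tabulate_arr_self_of_le _ _ (by omega) hx5.le]

theorem exists_leads_tables : ∃ p T, PolyBound T ∧ ∀ (E : State) (B : ℕ), 1 ≤ B →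
    (∀ g < 8, E.reg g ≤ B) → Sizes E → E.reg 5 = E.reg 1 * E.reg 0 →
    E.reg 6 = (E.reg 0 + 1) * E.reg 2 →
    ∃ E', Leads p (T B) E E' ∧ E'.reg = E.reg ∧ (∀ a < 4, E'.arr a = E.arr a) ∧ ReducedArray E' ∧
      TableArray E' ∧ PathArray E' ∧ ∀ i < E.reg 1, E'.arr 4 i = dist E' i (E'.arr 2 i) + 1 := by
  obtain ⟨p₆, T₆, hT₆, h₆⟩ := comp_keepEntry.exists_leads_tabulate 6 3 (by decide)
  obtain ⟨p₇, T₇, hT₇, h₇⟩ := comp_tblEntry.exists_leads_tabulate 7 6 (by decide)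
  obtain ⟨p₅, T₅, hT₅, h₅⟩ := comp_pathEntry.exists_leads_tabulate 5 5 (by decide)
  obtain ⟨p₄, T₄, hT₄, h₄⟩ := comp_lengthEntry.exists_leads_tabulate 4 1 (by decide)
  refine ⟨.seq p₆ (.seq p₇ (.seq p₅ p₄)), _, hT₆.add (hT₇.add (hT₅.add hT₄)), fun E B hB hE hs hr5 hr6 => ?_⟩
  have e₆ := h₆ E B hB hE
  have r₆ := reducedArray_tabulate hs
  set E₁ := tabulate 6 keepEntry E (E.reg 3) with hE₁
  have hreg₁ : E₁.reg = E.reg := tabulate_reg ..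
  have hs' : ∀ {E' : State}, E'.reg = E.reg → Sizes E' := fun {E'} h => by
    obtain ⟨h1, h2, h3, h4⟩ := hs
    constructor <;> rwa [h]
  have e₇ := h₇ E₁ B hB (by rwa [hreg₁])
  have r₇ := tableArray_tabulate (hs' hreg₁) (by rwa [hreg₁])
  set E₂ := tabulate 7 tblEntry E₁ (E₁.reg 6) with hE₂
  have hreg₂ : E₂.reg = E.reg := (tabulate_reg ..).trans hreg₁
  have S₂ : Same E₁ E₂ := .tabulate _ _
  have e₅ := h₅ E₂ B hB (by rwa [hreg₂])
  have r₅ := pathArray_tabulate (hs' hreg₂) (by rwa [hreg₂])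
  set E₃ := tabulate 5 pathEntry E₂ (E₂.reg 5) with hE₃
  have hreg₃ : E₃.reg = E.reg := (tabulate_reg ..).trans hreg₂
  have S₃ : Same E₂ E₃ := .tabulate _ _
  have e₄ := h₄ E₃ B hB (by rwa [hreg₃])
  set E₄ := tabulate 4 lengthEntry E₃ (E₃.reg 1) with hE₄
  have hreg₄ : E₄.reg = E.reg := (tabulate_reg ..).trans hreg₃
  have S₄ : Same E₃ E₄ := .tabulate _ _
  have a₂ : ∀ a, a ≠ 7 → E₂.arr a = E₁.arr a := fun a h => tabulate_arr_of_ne _ _ _ h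
  have a₃ : ∀ a, a ≠ 5 → E₃.arr a = E₂.arr a := fun a h => tabulate_arr_of_ne _ _ _ h
  have a₄ : ∀ a, a ≠ 4 → E₄.arr a = E₃.arr a := fun a h => tabulate_arr_of_ne _ _ _ h
  refine ⟨E₄, e₆.seq (e₇.seq (e₅.seq e₄)), hreg₄, fun a ha => ?_,
    ((r₆.congr S₂ (a₂ 1 (by decide))).congr S₃ (a₃ 1 (by decide))).congr S₄ (a₄ 1 (by decide)),
    (r₇.congr S₃ (a₃ 7 (by decide))).congr S₄ (a₄ 7 (by decide)),
    r₅.congr S₄ (a₄ 5 (by decide)) (a₄ 7 (by decide)), fun i hi => ?_⟩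
  · rw [a₄ a (by omega), a₃ a (by omega), a₂ a (by omega)]
    exact tabulate_arr_of_ne _ _ _ (by omega)
  · rw [hE₄, tabulate_arr_self _ _ (by rwa [hreg₃]), lengthEntry, ← hE₄, S₄.arr₂,
      S₄.dist (a₄ 7 (by decide))]
    have S₅ : Same E₃ (tabulate 4 lengthEntry E₃ i) := .tabulate _ _
    rw [S₅.arr₂, S₅.dist (tabulate_arr_of_ne _ _ _ (by decide))]

end Alg

end CCMAR

/-! ### From the tables back to the instance. -/

namespace CCMAR

open RAM Finset Relation

theorem simplePath_ofFn {V : Type*} {R : V → V → Prop} {m : ℕ} (f : Fin (m + 1) → V)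
    (hf : Function.Injective f)
    (hR : ∀ (j : ℕ) (h : j < m), R (f ⟨j, by omega⟩) (f ⟨j + 1, by omega⟩)) :
    SimplePath R (f 0) (f (Fin.last m)) (List.ofFn f) := by
  refine ⟨List.nodup_ofFn.2 hf, ?_, ?_, ?_⟩
  · rw [List.isChain_iff_getElem]
    intro i hi
    rw [List.length_ofFn] at hi
    simpa [-List.ofFn_succ] using hR i (by omega)
  · simp
  · simp [-List.ofFn_succ, List.getLast?_eq_getElem?, Fin.last]

-- Every edge arises from its two orientations. This is the source of the factor `2` between
-- `crossing` and the cost.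
open Classical in
theorem sum_adj {V : Type*} [Fintype V] (G : SimpleGraph V) (g : Sym2 V → ℕ) :
    ∑ u, ∑ v, (if G.Adj u v then g s(u, v) else 0) = 2 * ∑ e ∈ G.edgeFinset, g e := by
  rw [← sum_product', ← sum_filter, ← sum_fiberwise_of_maps_to (g := fun p : V × V => s(p.1, p.2))
    (t := G.edgeFinset) (fun p hp => by simpa using hp), mul_sum]
  refine sum_congr rfl fun e he => ?_
  induction e with
  | h a b =>
    have hab : G.Adj a b := by simpa using he
    have : ({p ∈ {p ∈ (univ : Finset V) ×ˢ univ | G.Adj p.1 p.2} | s(p.1, p.2) = s(a, b)} :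
        Finset (V × V)) = {(a, b), (b, a)} := by
      ext ⟨x, y⟩
      simp only [mem_filter, mem_product, mem_univ, true_and, Sym2.eq_iff, mem_insert,
        mem_singleton, Prod.mk.injEq, and_self]
      constructor
      · exact And.right
      · rintro (⟨rfl, rfl⟩ | ⟨rfl, rfl⟩)
        · exact ⟨hab, .inl ⟨rfl, rfl⟩⟩
        · exact ⟨hab.symm, .inr ⟨rfl, rfl⟩⟩
    rw [this, sum_pair (by simp [hab.ne]), Sym2.eq_swap, two_mul]

/-- The steps taken by the agents, as a relation between natural numbers. -/
def walkRel {n k : ℕ} (P : Fin k → List (Fin n)) (i a b : ℕ) : Prop :=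
  ∃ (hi : i < k) (ha : a < n) (hb : b < n), Traverses (P ⟨i, hi⟩) ⟨a, ha⟩ ⟨b, hb⟩

open Classical in
theorem load_eq {V : Type*} {k : ℕ} (P : Fin k → List V) (u v : V) :
    load P u v = ∑ i, if Traverses (P i) u v then 1 else 0 := by
  rw [load, Nat.card_eq_fintype_card, Fintype.card_subtype, card_filter]

/-- The instance is stored in the state. -/
structure Stored {n k : ℕ} (Γ : Inst (Fin n) k) (E : State) : Prop where
  reg₀ : E.reg 0 = n
  reg₁ : E.reg 1 = k
  arr : ∀ a < 4, E.arr a = (inputState Γ).arr a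

namespace Stored

variable {n k : ℕ} {Γ : Inst (Fin n) k} {E : State}

theorem matrixArray_index (M : Fin n → Fin n → ℕ) (u v : Fin n) :
    matrixArray M (u * n + v) = M u v := by
  have h : (u : ℕ) * n + v < n * n := Alg.index_lt u.2 v.2
  have e : (⟨u * n + v, h⟩ : Fin (n * n)) = finProdFinEquiv (u, v) := by
    ext; simp [finProdFinEquiv]; ring
  rw [matrixArray, dif_pos h, e]
  simp

variable (h : Stored Γ E)
include h

open Classical in
theorem wgt (u v : Fin n) :
    Alg.wgt E u v = if Γ.graph.edges.Adj u v then Γ.graph.weight s(u, v) else 0 := by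
  rw [Alg.wgt, h.reg₀, h.arr 0 (by decide)]
  exact matrixArray_index (fun u v => if Γ.graph.edges.Adj u v then Γ.graph.weight s(u, v) else 0) u v

theorem step₀ (u v : Fin n) : Alg.Step₀ E u v ↔ Γ.graph.Step u v := by
  classical
  have h1 : E.arr 1 (u * E.reg 0 + v) = if (u, v) ∈ Γ.graph.arcs then 1 else 0 := by
    rw [h.reg₀, h.arr 1 (by decide)]
    exact matrixArray_index (fun u v => if (u, v) ∈ Γ.graph.arcs then 1 else 0) u v
  rw [Alg.Step₀, h.wgt, h1, MixedGraph.Step]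
  refine or_congr ?_ (by simp)
  by_cases ha : Γ.graph.edges.Adj u v
  · have := Γ.graph.weight_pos s(u, v) ha
    simp only [ha, if_true]
    exact ⟨fun _ => trivial, fun _ => this.ne'⟩
  · simp [ha]

theorem source (i : Fin k) : E.arr 2 i = Γ.source i := by
  rw [h.arr 2 (by decide)]
  change vertexArray Γ.source i = _
  simp [vertexArray]

theorem target (i : Fin k) : E.arr 3 i = Γ.target i := by
  rw [h.arr 3 (by decide)]
  change vertexArray Γ.target i = _
  simp [vertexArray]

theorem crossing_eq (P : Fin k → List (Fin n)) :
    Alg.crossing E (walkRel P) = 2 * Γ.cost P := by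
  classical
  rw [Inst.cost, ← sum_adj, Alg.crossing, h.reg₀, h.reg₁, sum_range]
  refine sum_congr rfl fun u _ => ?_
  rw [sum_range]
  refine sum_congr rfl fun v _ => ?_
  have hw : ∀ (i : Fin k) (u v : Fin n), walkRel P i u v ↔ Traverses (P i) u v := fun i u v =>
    ⟨fun ⟨_, _, _, h⟩ => h, fun h => ⟨i.2, u.2, v.2, h⟩⟩
  simp only [sum_range, hw, h.wgt]
  split_ifs with ha
  · rw [Sym2.lift_mk]
    dsimp only
    rw [load_eq, load_eq, sum_mul_sum, mul_sum]
    refine sum_congr rfl fun i _ => ?_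
    rw [mul_sum]
    refine sum_congr rfl fun j _ => ?_
    by_cases h1 : Traverses (P i) u v <;> by_cases h2 : Traverses (P j) v u <;> simp [h1, h2]
  · simp

theorem walkRel_reach {P : Fin k → List (Fin n)} (hP : Γ.IsSolution P) (i : Fin k) :
    ReflTransGen (walkRel P i) (E.arr 2 i) (E.arr 3 i) := by
  rw [h.source, h.target]
  have : SimplePath Γ.graph.Step (Γ.source i) (Γ.target i) (P i) := hP i
  exact this.traverses.reach.lift (fun v : Fin n => (v : ℕ)) fun a b hab => ⟨i.2, a.2, b.2, hab⟩

/-- The dynamic program bounds the cost of every solution from below. -/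
theorem exists_le_cost (hE : Alg.Sizes E) (hred : Alg.ReducedArray E) (htbl : Alg.TableArray E)
    {P : Fin k → List (Fin n)} (hP : Γ.IsSolution P) :
    ∃ c < E.reg 2, Alg.At E 2 c ∧ Alg.tbl E (E.reg 0) c ≠ 0 ∧
      Alg.tbl E (E.reg 0) c ≤ 1 + 2 * Γ.cost P := by
  obtain ⟨U, h1, h2, h3⟩ := Alg.exists_reroute_red hred (fun i : Fin k => E.arr 2 i)
    (fun i => E.arr 3 i) (fun i => walkRel P i) (fun i a b ⟨_, ha, hb, hab⟩ => by
      refine ⟨by rwa [h.reg₀], by rwa [h.reg₀], ?_⟩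
      rw [if_neg (Nat.not_lt_zero _)]
      have hs : SimplePath Γ.graph.Step (Γ.source i) (Γ.target i) (P i) := hP i
      exact (h.step₀ ⟨a, ha⟩ ⟨b, hb⟩).2 (hs.of_traverses hab)) (h.walkRel_reach hP)
  obtain ⟨c, hc, hc2, hc0, hle⟩ := htbl.exists_le_crossing hE
    (fun i a b => ∃ hi : i < k, U ⟨i, hi⟩ a b) (fun i _ a b ⟨hi, hab⟩ => h1 _ a b hab)
    (fun i hi => by
      rw [h.reg₁] at hi
      rw [h.source ⟨i, hi⟩, h.reg₀]; exact (Γ.source _).2)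
    (fun i hi => by
      rw [h.reg₁] at hi
      exact (h2 ⟨i, hi⟩).weaken fun a b hab => ⟨hi, hab⟩)
  refine ⟨c, hc, hc2, hc0, hle.trans ?_⟩
  rw [← h.crossing_eq P]
  refine Nat.add_le_add_left (Alg.crossing_le fun i _ j _ u _ v _ => ?_) 1
  rintro ⟨hi, h4⟩ ⟨hj, h5⟩
  exact h3 ⟨i, hi⟩ ⟨j, hj⟩ u v h4 h5

/-- The paths read off from the tables form a minimum-cost solution. -/
theorem exists_output (hfeas : Γ.Feasible) (hE : Alg.Sizes E) (hred : Alg.ReducedArray E)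
    (htbl : Alg.TableArray E) (hpath : Alg.PathArray E)
    (hlen : ∀ i < E.reg 1, E.arr 4 i = Alg.dist E i (E.arr 2 i) + 1) :
    ∃ P : Fin k → List (Fin n), Γ.IsOptimal P ∧ IsOutput E P := by
  -- Feasibility supplies one solution, hence a nonzero table entry, without which no trajectory
  -- exists.
  choose P₀ hP₀ using hfeas
  obtain ⟨c₀, hc₀, hc₂, hc, -⟩ := h.exists_le_cost hE hred htbl (P := P₀) hP₀
  obtain ⟨hreach, -⟩ := htbl.allow_spec hE (Alg.reduced_red hred) hc₀ hc₂ hc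
  have hex : ∀ i : Fin k, ∃ p : List (Fin n),
      SimplePath (fun a b : Fin n => Alg.Allow E i a b) (Γ.source i) (Γ.target i) p ∧
      E.arr 4 i = p.length ∧
      ∀ j : Fin p.length, E.arr 5 (i * n + j) = (p.get j : ℕ) := by
    intro i
    have hi : (i : ℕ) < E.reg 1 := by rw [h.reg₁]; exact i.2
    have hs : E.arr 2 i < E.reg 0 := by rw [h.source, h.reg₀]; exact (Γ.source i).2
    obtain ⟨h1, h2, h3, h4, h5⟩ := hpath.spec hi hs (hreach i hi)
    have h4' := hlen i hi
    rw [h.reg₀] at h1 h2 h3 h4 h5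
    generalize Alg.dist E i (E.arr 2 i) = m at h1 h2 h3 h4 h5 h4'
    have hp := simplePath_ofFn (R := fun a b : Fin n => Alg.Allow E i a b)
      (fun j : Fin (m + 1) => (⟨E.arr 5 (i * n + j), (h2 j (by omega)).1⟩ : Fin n))
      -- Distances to the target differ at different positions, so the vertices are distinct.
      (fun a b hab => by
        have ha := (h2 a (by omega)).2
        have hb := (h2 b (by omega)).2
        simp only [Fin.mk.injEq] at hab
        rw [hab] at ha
        ext; omega) h3
    have e1 : (⟨E.arr 5 (i * n + (0 : Fin (m + 1))), (h2 _ (by omega)).1⟩ : Fin n) = Γ.source i := by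
      ext; simpa [h.source i] using h4
    have e2 : (⟨E.arr 5 (i * n + Fin.last m), (h2 _ (by omega)).1⟩ : Fin n) = Γ.target i := by
      ext; simpa [h.target i] using h5
    rw [e1, e2] at hp
    exact ⟨_, hp, by simpa using h4', fun j => by simp [-List.ofFn_succ]⟩
  choose P hP hP4 hP5 using hex
  refine ⟨P, ⟨fun i => (hP i).imp fun a b _ hab => ?_, fun Q hQ => ?_⟩, fun i => ⟨hP4 i, hP5 i⟩⟩
  · have hcur := Alg.cur_antitone hred (Nat.zero_le (E.reg 0 * E.reg 0)) le_rfl a b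
      (Alg.cur_last ▸ hab.1)
    exact (h.step₀ a b).1 (by simpa using hcur.2.2)
  · obtain ⟨c, hc, hc2, hc0, hle⟩ := h.exists_le_cost hE hred htbl hQ
    have h1 := (htbl.allow_spec hE (Alg.reduced_red hred) hc hc2 hc0).2
    have h2 : Alg.crossing E (walkRel P) ≤ Alg.crossing E (Alg.Allow E) := by
      refine Alg.crossing_le fun i _ j _ u _ v _ => ?_
      rintro ⟨hi, hu, hv, h3⟩ ⟨hj, _, _, h4⟩
      exact ⟨(hP ⟨i, hi⟩).of_traverses h3, (hP ⟨j, hj⟩).of_traverses h4⟩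
    rw [h.crossing_eq] at h2
    -- Twice the cost of `P` is at most the crossings of `Allow`, hence at most the table entry less
    -- one, hence at most twice the cost of `Q`.
    omega

end Stored

end CCMAR

/-! ### The main theorem and its running time. -/

theorem mainTheorem3 :
    ∃ (prog : RAM.Prog) (C : ℕ), ∀ (n k : ℕ) (Γ : CCMAR.Inst (Fin n) k), 1 ≤ k → Γ.Feasible →
      ∃ (σ : RAM.State) (t : ℕ), RAM.Exec prog (CCMAR.inputState Γ) σ t ∧
        t ≤ C * n ^ (C * k ^ 2) * k ^ C ∧
        ∃ P : Fin k → List (Fin n), Γ.IsOptimal P ∧ CCMAR.IsOutput σ P := by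
  obtain ⟨p, S, hS, hp⟩ := CCMAR.Alg.exists_leads_sizes
  obtain ⟨q, T, hT, hq⟩ := CCMAR.Alg.exists_leads_tables
  obtain ⟨c, d, hcd⟩ := hS.add hT
  -- The constant dominates the factor `c * 4 ^ d` of `c * B ^ d`, the coefficient `3 * d` in the
  -- exponent of `n`, and the exponent `d` of `k`.
  refine ⟨.seq p q, c * 4 ^ d + 3 * d, fun n k Γ hk hfeas => ?_⟩
  have hn : 0 < n := (Γ.source ⟨0, hk⟩).pos
  -- The required bound expands into the four terms `n * (n * n) ^ k`, `(n * n) ^ k`, `n * n` and `k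
  -- * n`, each at most `k * n ^ (3 * k)`.
  set B := 4 * k * n ^ (3 * k) with hBdef
  have hpow : ∀ {m}, m ≤ 3 * k → n ^ m ≤ n ^ (3 * k) := fun h => Nat.pow_le_pow_right hn h
  have h1 : 1 ≤ n ^ (3 * k) := Nat.one_le_pow _ _ hn
  have hn1 : n ≤ n ^ (3 * k) := by simpa using hpow (m := 1) (by omega)
  have hn2 : n * n ≤ n ^ (3 * k) := by simpa [pow_two] using hpow (m := 2) (by omega)
  have hn3 : n * (n * n) ^ k ≤ n ^ (3 * k) := by
    have := hpow (m := 2 * k + 1) (by omega)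
    rwa [pow_succ', pow_mul, pow_two] at this
  have hn4 : (n * n) ^ k ≤ n ^ (3 * k) := le_trans (Nat.le_mul_of_pos_left _ hn) hn3
  have hkn : k * n ≤ k * n ^ (3 * k) := Nat.mul_le_mul_left _ hn1
  have hkB : n ^ (3 * k) ≤ k * n ^ (3 * k) := Nat.le_mul_of_pos_left _ hk
  have hk1 : k ≤ k * n ^ (3 * k) := Nat.le_mul_of_pos_right _ h1
  have hB4 : B = 4 * (k * n ^ (3 * k)) := by rw [hBdef, mul_assoc]
  have hB : 1 ≤ B := by omega
  obtain ⟨E₁, l₁, b₁, a₁, r₀, r₁, s₁, r₅, r₆⟩ := hp (CCMAR.inputState Γ) B hB hn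
    (fun g _ => by
      match g with
      | 0 => exact (show n ≤ B by omega)
      | 1 => exact (show k ≤ B by omega)
      | _ + 2 => exact Nat.zero_le _)
    (show (n + 1) * (n * n) ^ k + n * n + k * n ≤ B by
      rw [add_mul, one_mul]; omega)
  obtain ⟨E₂, l₂, hreg, harr, hred, htbl, hpath, hlen⟩ := hq E₁ B hB b₁ s₁ r₅ r₆
  have hst : CCMAR.Stored Γ E₂ :=
    ⟨by rw [hreg, r₀]; rfl, by rw [hreg, r₁]; rfl, fun a ha => by rw [harr a ha, a₁]⟩
  obtain ⟨σ, t, he, ht, hσ⟩ := l₁.seq l₂ (CCMAR.inputState Γ) (RAM.Agree.refl _)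
  obtain ⟨P, hopt, hout⟩ := hst.exists_output hfeas
    (by obtain ⟨h1, h2, h3, h4⟩ := s₁; constructor <;> rwa [hreg]) hred htbl hpath
    (by rwa [hreg])
  refine ⟨σ, t, he, ?_, P, hopt, ?_⟩
  · refine (ht.trans (hcd B hB)).trans ?_
    set C := c * 4 ^ d + 3 * d with hC
    calc c * B ^ d = (c * 4 ^ d) * n ^ (3 * k * d) * k ^ d := by
          rw [hBdef, mul_pow, mul_pow, ← pow_mul]; ring
      _ ≤ C * n ^ (C * k ^ 2) * k ^ C := by
          have e1 : 3 * k * d ≤ C * k ^ 2 := by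
            have : k ≤ k ^ 2 := Nat.le_self_pow (by norm_num) k
            calc 3 * k * d = 3 * d * k := by ring
              _ ≤ C * k ^ 2 := Nat.mul_le_mul (by omega) this
          exact Nat.mul_le_mul (Nat.mul_le_mul (by omega) (Nat.pow_le_pow_right hn e1))
            (Nat.pow_le_pow_right hk (by omega))
  · intro i
    rw [show σ.arr = E₂.arr from hσ.2]
    exact hout i
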